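/- Let $\zeta'(-r)$ denote the derivative of the Riemann zeta function at $-r$ and $\gamma$ the Euler constant. Let $(G_n)_{n\ge 0}$ be the Vignéras multiple gamma functions, i.e. the unique hierarchy of meromorphic functions on $\mathbb{C}$ such that $G_0(z)=z$ and, for $n\ge 1$, (1) $G_n(z+1)=G_{n-1}(z)\,G_n(z)$, (2) $G_n(1)=1$, (3) $G_n(x+1)>0$ and $\frac{d^{n+1}}{dx^{n+1}}\log G_n(x+1)\ge 0$ for real $x\ge 0$. Then the following infinite products converge unconditionally and the following identities hold, the first and the third for all $z\in\mathbb{C}\setminus\{-1,-2,-3,\dots\}$, the second for all $z\in\mathbb{C}$ (where a product with a vanishing factor has the value $0$): $$G_3(z+1)=\exp\Big\{-\tfrac{z^3}{4}+\tfrac{z^2}{8}+\tfrac{7}{24}z+z\,\zeta'(-1)-\tfrac{z(z-1)}{2}\zeta'(0)-\Big(\tfrac{z^3}{6}-\tfrac{z^2}{4}\Big)\gamma\Big\}$$ $$\qquad\times\prod_{k=1}^\infty\Big[\Big(1+\tfrac zk\Big)^{-\frac{k(k+1)}{2}}\exp\Big\{\Big(\tfrac{z^3}{6}-\tfrac{z^2}{4}\Big)\tfrac1k-\Big(\tfrac{z^2}{4}-\tfrac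 z2\Big)+\tfrac z2k\Big\}\Big],$$ $$G_4(z+1)=\exp\Big\{-\tfrac{11}{144}z^4+\tfrac29z^3-\tfrac{5}{144}z^2-\tfrac{5}{24}z-\tfrac z2\zeta'(-2)+\tfrac{z^2-2z}{2}\zeta'(-1)-\tfrac{z^3-3z^2+2z}{6}\zeta'(0)-\tfrac{z^4-4z^3+4z^2}{24}\gamma\Big\}$$ $$\qquad\times\prod_{k=1}^\infty\Big[\Big(1+\tfrac zk\Big)^{\frac{k(k+1)(k+2)}{6}}\exp\Big\{\Big(\tfrac{z^4}{24}-\tfrac{z^3}{6}+\tfrac{z^2}{6}\Big)\tfrac1k-\Big(\tfrac{z^3}{18}-\tfrac{z^2}{4}+\tfrac z3\Big)+\Big(\tfrac{z^2}{12}-\tfrac z2\Big)k-\tfrac z6k^2\Big\}\Big],$$ $$G_5(z+1)=\exp\Big\{-\tfrac{5}{288}z^5+\tfrac{7}{64}z^4-\tfrac{161}{864}z^3+\tfrac{469}{2880}z+\tfrac z6\zeta'(-3)-\tfrac{z^2-3z}{4}\zeta'(-2)+\tfrac{2z^3-9z^2+11z}{12}\zeta'(-1)$$ $$\qquad\qquad-\tfrac{z^4-6z^3+11z^2-6z}{24}\zeta'(0)-\tfrac{6z^5-45z^4+110z^3-90z^2}{720}\gamma\Big\}$$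 $$\qquad\times\prod_{k=1}^\infty\Big[\Big(1+\tfrac zk\Big)^{-\frac{k(k+1)(k+2)(k+3)}{24}}\exp\Big\{\Big(\tfrac{z^5}{120}-\tfrac{z^4}{16}+\tfrac{11}{72}z^3-\tfrac{z^2}{8}\Big)\tfrac1k-\Big(\tfrac{z^4}{96}-\tfrac{z^3}{12}+\tfrac{11}{48}z^2-\tfrac z4\Big)$$ $$\qquad\qquad+\Big(\tfrac{z^3}{72}-\tfrac{z^2}{8}+\tfrac{11}{24}z\Big)k-\Big(\tfrac{z^2}{48}-\tfrac z4\Big)k^2+\tfrac{z}{24}k^3\Big\}\Big].$$ -/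

import Mathlib

/-- `IsNextMultipleGamma n g f` says that `f` is the level `n + 1` function of the hierarchy of
multiple gamma functions, when `g` is its level `n` function:
`f` is meromorphic on `ℂ`, `f (z + 1) = g z * f z`, `f 1 = 1`, and
`d ^ (n + 2) / dx ^ (n + 2) log f (x + 1) ≥ 0` for real `x ≥ 0`
(in particular `f (x + 1)` is a positive real number there, so that the logarithm makes sense).

Meromorphic functions are taken in normal form: removable singularities are removed, and the value
at a pole is `0`. The functional equation is required off the possible
poles `0, -1, -2, …` of `g` and `f`. -/
structure IsNextMultipleGamma (n : ℕ) (g f : ℂ → ℂ) : Prop where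
  meromorphic : MeromorphicNFOn f Set.univ
  map_add_one : ∀ z : ℂ, (∀ m : ℕ, z ≠ -(m : ℂ)) → f (z + 1) = g z * f z
  map_one : f 1 = 1
  pos : ∀ x : ℝ, 0 ≤ x → (f ((x : ℂ) + 1)).im = 0 ∧ 0 < (f ((x : ℂ) + 1)).re
  iteratedDeriv_log_nonneg : ∀ x : ℝ, 0 ≤ x →
    0 ≤ iteratedDeriv (n + 2) (fun t : ℝ => Real.log (f ((t : ℂ) + 1)).re) x

/-- The Vignéras multiple gamma functions `G_n`: `G_0 (z) = z`, and `G_(n+1)` is the function which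
satisfies the (generalized Bohr-Mollerup) conditions `IsNextMultipleGamma` relative to `G_n`.
(`Classical.epsilon P` satisfies `P` as soon as something does, and nothing can be proved about it
otherwise; here exactly one function satisfies the conditions. `G_1` is the gamma function and
`G_2` is the Barnes `G`-function.) -/
noncomputable def multipleGamma : ℕ → ℂ → ℂ
  | 0 => fun z => z
  | n + 1 => Classical.epsilon fun f : ℂ → ℂ => IsNextMultipleGamma n (multipleGamma n) f

/-- The `k`-th factor of the Weierstrass product of `G_3 (z + 1)`. The division in the integer
exponent is exact (and likewise in the factors below). -/
noncomputable def weierstrassFactorThree (z : ℂ) (k : ℕ+) : ℂ :=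
  (1 + z / (k : ℂ)) ^ (-((k : ℤ) * ((k : ℤ) + 1) / 2)) *
    Complex.exp ((z ^ 3 / 6 - z ^ 2 / 4) * (1 / (k : ℂ)) - (z ^ 2 / 4 - z / 2) + z / 2 * (k : ℂ))

/-- The `k`-th factor of the Weierstrass product of `G_4 (z + 1)`. -/
noncomputable def weierstrassFactorFour (z : ℂ) (k : ℕ+) : ℂ :=
  (1 + z / (k : ℂ)) ^ ((k : ℤ) * ((k : ℤ) + 1) * ((k : ℤ) + 2) / 6) *
    Complex.exp ((z ^ 4 / 24 - z ^ 3 / 6 + z ^ 2 / 6) * (1 / (k : ℂ))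
      - (z ^ 3 / 18 - z ^ 2 / 4 + z / 3)
      + (z ^ 2 / 12 - z / 2) * (k : ℂ)
      - z / 6 * (k : ℂ) ^ 2)

/-- The `k`-th factor of the Weierstrass product of `G_5 (z + 1)`. -/
noncomputable def weierstrassFactorFive (z : ℂ) (k : ℕ+) : ℂ :=
  (1 + z / (k : ℂ)) ^ (-((k : ℤ) * ((k : ℤ) + 1) * ((k : ℤ) + 2) * ((k : ℤ) + 3) / 24)) *
    Complex.exp ((z ^ 5 / 120 - z ^ 4 / 16 + 11 / 72 * z ^ 3 - z ^ 2 / 8) * (1 / (k : ℂ))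
      - (z ^ 4 / 96 - z ^ 3 / 12 + 11 / 48 * z ^ 2 - z / 4)
      + (z ^ 3 / 72 - z ^ 2 / 8 + 11 / 24 * z) * (k : ℂ)
      - (z ^ 2 / 48 - z / 4) * (k : ℂ) ^ 2
      + z / 24 * (k : ℂ) ^ 3)

/-!
Uniqueness: for two functions with the same functional equation and convexity, the derivatives of
order `n + 1` of the logarithms are monotone on the positive axis, and their difference is periodic.
By monotonicity its oscillation on a period is bounded by the corresponding derivative of the
logarithm of `G_n`, which tends to `0`; so the difference is constant.

Existence: the number `W k` of multisets of `n` elements out of `k` is a polynomial in `k`, so that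
the canonical product `∏ (1 + z / k) ^ W k * exp (-T k z)`, where `T k z` collects the terms of
`W k * log (1 + z / k)` of order at least `1 / k`, converges. The derivative of order `n + 2` of its
logarithm is, up to the sign `(-1) ^ (n + 1)`, the positive series
`∑ W k * (n + 1)! / (z + k) ^ (n + 2)`, which gives the convexity. Since `W (k + 1) - W k` is the
multiplicity of `k + 1` one level lower, shifting `z` by `1` in the partial products telescopes, up
to an exponential whose exponent is a combination of the sums `∑ k ^ j`, `∑ 1 / k` and
`∑ k ^ j * log k`. The Euler-Maclaurin expansion of the last of these has the constant term
`-ζ'(-j)`. All divergent terms cancel, and the polynomial in `z` which remains is the difference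
of exponents for which `exp (P z)` has to compensate.
-/

section

open Filter Topology Finset

/-! ### Euler-Maclaurin continuation of the zeta function -/

lemma norm_sub_taylor_sum_le {n : ℕ} {g : ℕ → ℝ → ℂ} {C : ℝ}
    (hg : ∀ i < n, ∀ x ∈ Set.Icc (0 : ℝ) 1, HasDerivAt (g i) (g (i + 1) x) x)
    (hC : ∀ x ∈ Set.Icc (0 : ℝ) 1, ‖g n x‖ ≤ C) {x : ℝ} (hx : x ∈ Set.Icc (0 : ℝ) 1) :
    ‖g 0 x - ∑ i ∈ range n, (x : ℂ) ^ i / (i.factorial : ℂ) * g i 0‖ ≤ C := by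
  induction n generalizing g x with
  | zero => simpa using hC x hx
  | succ n ih =>
    set φ : ℝ → ℂ := fun x => g 0 x - ∑ i ∈ range (n + 1), (x : ℂ) ^ i / (i.factorial : ℂ) * g i 0
      with hφ
    have hderiv : ∀ y ∈ Set.Icc (0 : ℝ) 1, HasDerivAt φ
        (g 1 y - ∑ i ∈ range n, (y : ℂ) ^ i / (i.factorial : ℂ) * g (i + 1) 0) y := by
      refine fun y hy => (hg 0 (by omega) y hy).sub ?_
      have hsum : HasDerivAt (fun x : ℝ => ∑ i ∈ range (n + 1),
          (x : ℂ) ^ i / (i.factorial : ℂ) * g i 0)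
          (∑ i ∈ range (n + 1), ((i : ℂ) * (y : ℂ) ^ (i - 1)) / (i.factorial : ℂ) * g i 0) y :=
        HasDerivAt.fun_sum fun i _ =>
          (((hasDerivAt_pow i (y : ℂ)).comp_ofReal).div_const _).mul_const _
      convert! hsum using 1
      rw [sum_range_succ']
      simp only [CharP.cast_eq_zero, zero_mul, zero_div, add_zero, Nat.add_sub_cancel]
      refine sum_congr rfl fun i _ => ?_
      rw [Nat.factorial_succ, Nat.cast_mul,
        mul_div_mul_left _ _ (Nat.cast_ne_zero.2 i.succ_ne_zero)]
    have hφ0 : φ 0 = 0 := by simp [hφ, sum_range_succ']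
    have hφx : ‖φ x - φ 0‖ ≤ C * ‖x - 0‖ :=
      (convex_Icc (0 : ℝ) 1).norm_image_sub_le_of_norm_hasDerivWithin_le
        (fun y hy => (hderiv y hy).hasDerivWithinAt)
        (fun y hy => ih (g := fun i => g (i + 1)) (fun i hi => hg (i + 1) (by omega)) hC hy)
        (Set.left_mem_Icc.2 zero_le_one) hx
    rw [hφ0, sub_zero, sub_zero, Real.norm_of_nonneg hx.1] at hφx
    exact hφx.trans (mul_le_of_le_one_right ((norm_nonneg _).trans (hC x hx)) hx.2)

/-- The coefficient `B_i / i!` of Euler-Maclaurin summation, with the convention `B_1 = 1 / 2`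
that belongs to sums over `1 ≤ k ≤ N`. -/
noncomputable def eulerMaclaurinCoeff (i : ℕ) : ℂ :=
  (bernoulli' i : ℂ) / (i.factorial : ℂ)

lemma sum_eulerMaclaurinCoeff_div_factorial (n : ℕ) :
    ∑ k ∈ range (n + 1), eulerMaclaurinCoeff k / ((n - k).factorial : ℂ)
      = n / (n.factorial : ℂ) + eulerMaclaurinCoeff n := by
  have hsum : ∑ k ∈ range n, (n.choose k : ℂ) * (bernoulli' k : ℂ) = n := by
    exact_mod_cast congrArg (Rat.cast : ℚ → ℂ) (sum_bernoulli' n)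
  rw [sum_range_succ, Nat.sub_self, Nat.factorial_zero, Nat.cast_one, div_one, ← hsum, sum_div]
  congr 1
  refine sum_congr rfl fun k hk => ?_
  rw [Nat.cast_choose ℂ (mem_range.1 hk).le, eulerMaclaurinCoeff]
  field_simp [Nat.factorial_ne_zero]

lemma sum_eulerMaclaurinCoeff_mul_sum (M : ℕ) (a : ℕ → ℂ) :
    ∑ i ∈ range M, eulerMaclaurinCoeff i * ∑ m ∈ range (M - i), a (i + m) / (m.factorial : ℂ)
      = ∑ n ∈ range M, (n / (n.factorial : ℂ) + eulerMaclaurinCoeff n) * a n := by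
  simp only [mul_sum, ← sum_range_diag_flip, ← sum_eulerMaclaurinCoeff_div_factorial, sum_mul]
  refine sum_congr rfl fun n _ => sum_congr rfl fun k hk => ?_
  rw [Nat.add_sub_cancel' (Nat.lt_succ_iff.1 (mem_range.1 hk))]
  ring

lemma norm_eulerMaclaurin_step_le {M : ℕ} {g : ℕ → ℝ → ℂ} {C : ℝ}
    (hg : ∀ i < M + 1, ∀ x ∈ Set.Icc (0 : ℝ) 1, HasDerivAt (g i) (g (i + 1) x) x)
    (hC : ∀ x ∈ Set.Icc (0 : ℝ) 1, ‖g (M + 1) x‖ ≤ C) :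
    ‖g 1 1 - ∑ i ∈ range (M + 1), eulerMaclaurinCoeff i * (g i 1 - g i 0)‖
      ≤ (1 + ∑ i ∈ range (M + 1), ‖eulerMaclaurinCoeff i‖) * C := by
  set t : ℕ → ℂ := fun i => g i 1 - ∑ m ∈ range (M + 1 - i), g (i + m) 0 / (m.factorial : ℂ)
    with ht
  have ht_le : ∀ i ≤ M + 1, ‖t i‖ ≤ C := fun i hi => by
    have := norm_sub_taylor_sum_le (n := M + 1 - i) (g := fun m => g (i + m))
      (fun m hm => hg (i + m) (by omega)) (by simpa only [Nat.add_sub_cancel' hi] using hC)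
      (Set.right_mem_Icc.2 zero_le_one)
    simpa [t, div_eq_inv_mul] using this
  have ht_one : t 1 = g 1 1 - ∑ n ∈ range (M + 1), n / (n.factorial : ℂ) * g n 0 := by
    simp only [ht, sum_range_succ', Nat.add_sub_cancel, Nat.cast_zero, zero_div, zero_mul, add_zero]
    congr 1
    refine sum_congr rfl fun n _ => ?_
    rw [Nat.factorial_succ, Nat.cast_mul, div_mul_cancel_left₀ (Nat.cast_ne_zero.2 n.succ_ne_zero),
      add_comm 1 n, div_eq_inv_mul]
  have ht_sum : ∑ i ∈ range (M + 1), eulerMaclaurinCoeff i * t i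
      = ∑ i ∈ range (M + 1), eulerMaclaurinCoeff i * g i 1
        - ∑ n ∈ range (M + 1), (n / (n.factorial : ℂ) + eulerMaclaurinCoeff n) * g n 0 := by
    rw [← sum_eulerMaclaurinCoeff_mul_sum, ← sum_sub_distrib]
    exact sum_congr rfl fun i _ => mul_sub _ _ _
  have hstep : g 1 1 - ∑ i ∈ range (M + 1), eulerMaclaurinCoeff i * (g i 1 - g i 0)
      = t 1 - ∑ i ∈ range (M + 1), eulerMaclaurinCoeff i * t i := by
    rw [ht_one, ht_sum]
    simp only [mul_sub, add_mul, sum_sub_distrib, sum_add_distrib]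
    ring
  rw [hstep, add_mul, one_mul, sum_mul]
  refine (norm_sub_le _ _).trans (add_le_add (ht_le 1 (by omega)) (norm_sum_le_of_le _ ?_))
  intro i hi
  rw [norm_mul]
  exact mul_le_mul_of_nonneg_left (ht_le i (mem_range.1 hi).le) (norm_nonneg _)

/-- The `i`-th derivative of `x ↦ -x ^ (1 - s)`. -/
noncomputable def cpowDeriv (s : ℂ) (i : ℕ) (x : ℝ) : ℂ :=
  -(∏ j ∈ range i, (1 - s - j)) * (x : ℂ) ^ (1 - s - i)

lemma hasDerivAt_cpowDeriv (s : ℂ) (i : ℕ) {x : ℝ} (hx : 0 < x) :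
    HasDerivAt (cpowDeriv s i) (cpowDeriv s (i + 1) x) x := by
  have h := ((hasDerivAt_id (x : ℂ)).cpow_const (c := 1 - s - i)
    (Complex.ofReal_mem_slitPlane.2 hx)).comp_ofReal.const_mul (-(∏ j ∈ range i, (1 - s - j)))
  convert! h using 1
  simp only [cpowDeriv, prod_range_succ, id]
  push_cast
  rw [sub_sub (1 - s) (i : ℂ) 1]
  ring

lemma differentiable_cpowDeriv (i : ℕ) {x : ℝ} (hx : 0 < x) :
    Differentiable ℂ fun s => cpowDeriv s i x := by
  have hx' : (x : ℂ) ≠ 0 := Complex.ofReal_ne_zero.2 hx.ne'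
  exact Differentiable.mul (by fun_prop) fun s =>
    DifferentiableAt.const_cpow (by fun_prop) (.inl hx')

lemma norm_cpowDeriv (s : ℂ) (i : ℕ) {x : ℝ} (hx : 0 < x) :
    ‖cpowDeriv s i x‖ = (∏ j ∈ range i, ‖1 - s - j‖) * x ^ (1 - s.re - i) := by
  rw [cpowDeriv, norm_mul, norm_neg, norm_prod, Complex.norm_cpow_eq_rpow_re_of_pos hx]
  simp

lemma tendsto_cpowDeriv {s : ℂ} {i : ℕ} (hs : 1 < s.re + i) :
    Tendsto (fun N : ℕ => cpowDeriv s i N) atTop (𝓝 0) := by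
  rw [tendsto_zero_iff_norm_tendsto_zero, ← mul_zero (∏ j ∈ range i, ‖1 - s - j‖)]
  have hpow : Tendsto (fun N : ℕ => (N : ℝ) ^ (-(s.re + i - 1))) atTop (𝓝 0) :=
    (tendsto_rpow_neg_atTop (by linarith)).comp tendsto_natCast_atTop_atTop
  refine (hpow.const_mul _).congr' ?_
  filter_upwards [eventually_gt_atTop 0] with N hN
  rw [norm_cpowDeriv s i (Nat.cast_pos.2 hN)]
  congr 2
  ring

lemma norm_cpowDeriv_le {M : ℕ} {s : ℂ} {R x a : ℝ} (hs : 3 - M ≤ s.re) (hR : ‖s‖ ≤ R)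
    (ha : 1 ≤ a) (hx : a ≤ x) :
    ‖cpowDeriv s M x‖ ≤ (1 + R + M) ^ M * (1 / a ^ 2) := by
  have hx1 : 1 ≤ x := ha.trans hx
  rw [norm_cpowDeriv s M (by linarith)]
  have hR0 : 0 ≤ R := (norm_nonneg _).trans hR
  gcongr
  · refine (prod_le_prod (fun _ _ => norm_nonneg _) fun j hj => ?_).trans_eq
      (prod_const (1 + R + M) |>.trans (by rw [card_range]))
    have hj : (j : ℝ) ≤ M := Nat.cast_le.2 (mem_range.1 hj).le
    calc ‖1 - s - (j : ℂ)‖ ≤ ‖(1 : ℂ)‖ + ‖s‖ + ‖(j : ℂ)‖ :=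
          (norm_sub_le _ _).trans (add_le_add (norm_sub_le _ _) le_rfl)
      _ ≤ 1 + R + M := by rw [norm_one, Complex.norm_natCast]; linarith
  · calc x ^ (1 - s.re - M) ≤ x ^ (-2 : ℝ) :=
          Real.rpow_le_rpow_of_exponent_le hx1 (by linarith)
      _ = 1 / x ^ 2 := by rw [Real.rpow_neg (by linarith), one_div, Real.rpow_ofNat]
      _ ≤ 1 / a ^ 2 := by gcongr

/-- The correction terms of Euler-Maclaurin summation of order `M` for `∑ (s - 1) * k ^ (-s)`. -/
noncomputable def zetaCorrection (M : ℕ) (s : ℂ) (x : ℝ) : ℂ :=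
  ∑ i ∈ range (M + 1), eulerMaclaurinCoeff i * cpowDeriv s i x

/-- The Euler-Maclaurin approximation of order `M` of `(s - 1) * ζ(s)`, with `N` terms of the
Dirichlet series. -/
noncomputable def zetaApprox (M N : ℕ) (s : ℂ) : ℂ :=
  (s - 1) * ∑ k ∈ range N, ((k + 1 : ℕ) : ℂ) ^ (-s) - zetaCorrection M s N

lemma differentiable_zetaApprox {N : ℕ} (M : ℕ) (hN : 0 < N) :
    Differentiable ℂ (zetaApprox M N) := by
  have hsum : Differentiable ℂ fun s : ℂ => ∑ k ∈ range N, ((k + 1 : ℕ) : ℂ) ^ (-s) :=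
    Differentiable.fun_sum fun k _ s =>
      DifferentiableAt.const_cpow (by fun_prop) (.inl (Nat.cast_ne_zero.2 k.succ_ne_zero))
  exact ((differentiable_id.sub_const 1).mul hsum).sub (Differentiable.fun_sum fun i _ =>
    (differentiable_cpowDeriv i (Nat.cast_pos.2 hN)).const_mul _)

/-- A summable bound for the increments of `zetaApprox M` which is uniform in `‖s‖ ≤ R`. -/
noncomputable def zetaApproxBound (M : ℕ) (R : ℝ) (k : ℕ) : ℝ :=
  (1 + ∑ i ∈ range (M + 1), ‖eulerMaclaurinCoeff i‖)
    * ((1 + R + (M + 1 : ℕ)) ^ (M + 1) * (1 / ((k : ℝ) + 1) ^ 2))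

lemma summable_zetaApproxBound (M : ℕ) (R : ℝ) : Summable (zetaApproxBound M R) := by
  have := (summable_nat_add_iff 1).2 (Real.summable_one_div_nat_pow.2 one_lt_two)
  push_cast at this
  exact (this.mul_left _).mul_left _

lemma zetaApprox_sub (M k : ℕ) (s : ℂ) :
    zetaApprox M (k + 2) s - zetaApprox M (k + 1) s
      = cpowDeriv s 1 (k + 2) - ∑ i ∈ range (M + 1),
        eulerMaclaurinCoeff i * (cpowDeriv s i (k + 2) - cpowDeriv s i (k + 1)) := by
  have hterm : cpowDeriv s 1 (k + 2) = (s - 1) * ((k + 1 + 1 : ℕ) : ℂ) ^ (-s) := by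
    simp only [cpowDeriv, prod_range_one]
    push_cast
    rw [show (1 - s - 1 : ℂ) = -s by ring, show (k + 2 : ℂ) = k + 1 + 1 by ring]
    ring
  simp only [zetaApprox, zetaCorrection, sum_range_succ _ (k + 1), hterm, mul_sub, sum_sub_distrib]
  push_cast
  ring

lemma norm_zetaApprox_sub_le {M : ℕ} {s : ℂ} {R : ℝ} (hs : 2 - M < s.re) (hR : ‖s‖ ≤ R) (k : ℕ) :
    ‖zetaApprox M (k + 2) s - zetaApprox M (k + 1) s‖ ≤ zetaApproxBound M R k := by
  have hstep := norm_eulerMaclaurin_step_le (M := M) (g := fun i h => cpowDeriv s i (h + (k + 1)))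
    (C := (1 + R + (M + 1 : ℕ)) ^ (M + 1) * (1 / ((k : ℝ) + 1) ^ 2))
    (fun i _ x hx =>
      (hasDerivAt_cpowDeriv s i (by have := hx.1; positivity)).comp_add_const x _)
    (fun x hx => norm_cpowDeriv_le (by push_cast; linarith) hR (by simp) (by simpa using hx.1))
  rw [zetaApprox_sub]
  simp only [zero_add, show (1 : ℝ) + (k + 1) = k + 2 by ring] at hstep
  exact hstep

/-- The analytic continuation of `(s - 1) * ζ(s)` given by Euler-Maclaurin summation. -/
noncomputable def zetaLimit (M : ℕ) (s : ℂ) : ℂ :=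
  zetaApprox M 1 s + ∑' k, (zetaApprox M (k + 2) s - zetaApprox M (k + 1) s)

lemma isOpen_lt_re (c : ℝ) : IsOpen {s : ℂ | c < s.re} :=
  isOpen_lt continuous_const Complex.continuous_re

lemma tendstoLocallyUniformlyOn_zetaApprox (M : ℕ) :
    TendstoLocallyUniformlyOn (fun N => zetaApprox M (N + 1)) (zetaLimit M) atTop
      {s : ℂ | 2 - M < s.re} := by
  rw [tendstoLocallyUniformlyOn_iff_forall_isCompact (isOpen_lt_re _)]
  intro K hK hKc
  obtain ⟨R, hR⟩ := hKc.isBounded.exists_norm_le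
  have hsum := tendstoUniformlyOn_tsum_nat (s := K)
    (f := fun k s => zetaApprox M (k + 2) s - zetaApprox M (k + 1) s)
    (summable_zetaApproxBound M R) (fun k s hs => norm_zetaApprox_sub_le (hK hs) (hR s hs) k)
  have hadd : TendstoUniformlyOn (fun N s => zetaApprox M 1 s
      + ∑ k ∈ range N, (zetaApprox M (k + 2) s - zetaApprox M (k + 1) s))
      (zetaLimit M) atTop K := by
    rw [Metric.tendstoUniformlyOn_iff] at hsum ⊢
    simpa only [zetaLimit, dist_add_left] using hsum
  refine hadd.congr (.of_forall fun N s _ => ?_)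
  simp only [sum_range_sub (fun k => zetaApprox M (k + 1) s)]
  ring

lemma tendsto_zetaApprox_of_one_lt_re (M : ℕ) {s : ℂ} (hs : 1 < s.re) :
    Tendsto (fun N => zetaApprox M N s) atTop (𝓝 (riemannZeta₁ s)) := by
  have hs1 : s ≠ 1 := by rintro rfl; simp at hs
  have hsum : Tendsto (fun N : ℕ => ∑ k ∈ range N, ((k + 1 : ℕ) : ℂ) ^ (-s)) atTop
      (𝓝 (riemannZeta s)) := by
    rw [zeta_eq_tsum_one_div_nat_add_one_cpow hs]
    have := ((summable_nat_add_iff 1).2 (Complex.summable_one_div_nat_cpow.2 hs)).hasSum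
    simpa [Complex.cpow_neg] using this.tendsto_sum_nat
  have hcorr : Tendsto (fun N : ℕ => zetaCorrection M s N) atTop (𝓝 0) := by
    rw [← sum_const_zero (s := range (M + 1))]
    refine tendsto_finsetSum _ fun i _ => ?_
    simpa using (tendsto_cpowDeriv (i := i) (hs.trans_le (by simp))).const_mul
      (eulerMaclaurinCoeff i)
  have := (hsum.const_mul (s - 1)).sub hcorr
  rwa [sub_zero, riemannZeta_eq_inv_sub_mul hs1, mul_inv_cancel_left₀ (sub_ne_zero.2 hs1)] at this

lemma eqOn_zetaLimit {M : ℕ} : Set.EqOn (zetaLimit M) riemannZeta₁ {s : ℂ | 2 - M < s.re} := by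
  have hopen := isOpen_lt_re (2 - M)
  have hlim := tendstoLocallyUniformlyOn_zetaApprox M
  have hdiff := hlim.differentiableOn
    (.of_forall fun N => (differentiable_zetaApprox M N.succ_pos).differentiableOn) hopen
  refine (hdiff.analyticOnNhd hopen).eqOn_of_preconnected_of_eventuallyEq
    (differentiable_riemannZeta₁.differentiableOn.analyticOnNhd hopen)
    (convex_halfSpace_re_gt _).isPreconnected (z₀ := 3) ?_ ?_
  · simp only [Set.mem_ofPred_eq, Complex.re_ofNat]
    linarith [(Nat.cast_nonneg M : (0 : ℝ) ≤ M)]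
  · filter_upwards [(isOpen_lt_re 2).mem_nhds (show (2 : ℝ) < (3 : ℂ).re by norm_num)] with s hs
    refine tendsto_nhds_unique (hlim.tendsto_at ?_)
      ((tendsto_add_atTop_iff_nat 1).2 (tendsto_zetaApprox_of_one_lt_re M (by linarith)))
    simp only [Set.mem_ofPred_eq]
    linarith [(Nat.cast_nonneg M : (0 : ℝ) ≤ M)]

lemma tendsto_deriv_zetaApprox {M : ℕ} {s : ℂ} (hs : 2 - M < s.re) (hs1 : s ≠ 1) :
    Tendsto (fun N : ℕ => deriv (fun w => (w - 1)⁻¹ * zetaApprox M N w) s) atTop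
      (𝓝 (deriv riemannZeta s)) := by
  have hlim := (tendstoLocallyUniformlyOn_zetaApprox M).congr_right eqOn_zetaLimit
  have hval : Tendsto (fun N => zetaApprox M (N + 1) s) atTop (𝓝 _) := hlim.tendsto_at hs
  have hder : Tendsto (fun N => deriv (zetaApprox M (N + 1)) s) atTop (𝓝 _) :=
    (hlim.deriv (.of_forall fun N => (differentiable_zetaApprox M N.succ_pos).differentiableOn)
      (isOpen_lt_re _)).tendsto_at hs
  rw [deriv_riemannZeta_eq_neg_inv_sub_sq_mul_add hs1, ← tendsto_add_atTop_iff_nat 1]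
  refine ((hval.const_mul _).add (hder.const_mul _)).congr fun N => ?_
  have hinv : HasDerivAt (fun s : ℂ => (s - 1)⁻¹) (-((s - 1)⁻¹) ^ 2) s := by
    convert! ((hasDerivAt_id s).sub_const 1).inv (sub_ne_zero.2 hs1) using 1
    simp [neg_div]
  exact (hinv.mul (differentiable_zetaApprox M N.succ_pos s).hasDerivAt).deriv.symm

/-- The coefficient of `x ^ (1 - s - i)` in the `i`-th derivative of `x ↦ x ^ (1 - s) / (1 - s)`. -/
noncomputable def cpowCoeff (i : ℕ) (s : ℂ) : ℂ :=
  (∏ l ∈ range i, (1 - s - l)) / (1 - s)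

lemma inv_mul_cpowDeriv (s : ℂ) (i : ℕ) (x : ℝ) :
    (s - 1)⁻¹ * cpowDeriv s i x = cpowCoeff i s * (x : ℂ) ^ (1 - i - s) := by
  rw [cpowDeriv, cpowCoeff, show 1 - s - i = 1 - i - s by ring, ← neg_sub 1 s, inv_neg]
  ring

lemma hasDerivAt_cpow_const_sub {x : ℝ} (hx : 0 < x) (c s : ℂ) :
    HasDerivAt (fun s : ℂ => (x : ℂ) ^ (c - s)) (-((Real.log x : ℂ) * (x : ℂ) ^ (c - s))) s := by
  convert! ((hasDerivAt_id s).const_sub c).const_cpow (c := (x : ℂ))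
    (.inl (Complex.ofReal_ne_zero.2 hx.ne')) using 1
  rw [Complex.ofReal_log hx.le]
  simp only [id]
  ring

lemma hasDerivAt_inv_mul_zetaApprox {s : ℂ} (hs : s ≠ 1) (M : ℕ) {N : ℕ} (hN : 0 < N) :
    HasDerivAt (fun w => (w - 1)⁻¹ * zetaApprox M N w)
      (-∑ k ∈ range N, (Real.log (k + 1) : ℂ) * ((k + 1 : ℕ) : ℂ) ^ (-s)
        - ∑ i ∈ range (M + 1), eulerMaclaurinCoeff i *
          (deriv (cpowCoeff i) s - cpowCoeff i s * Real.log N) * (N : ℂ) ^ (1 - i - s)) s := by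
  have hcoeff : ∀ i, DifferentiableAt ℂ (cpowCoeff i) s := fun i =>
    DifferentiableAt.div (by fun_prop) (by fun_prop) (sub_ne_zero.2 hs.symm)
  have hsum := HasDerivAt.fun_sum fun k (_ : k ∈ range N) =>
    hasDerivAt_cpow_const_sub (x := (k : ℝ) + 1) (by positivity) 0 s
  have hcorr := HasDerivAt.fun_sum fun i (_ : i ∈ range (M + 1)) =>
    ((hcoeff i).hasDerivAt.mul (hasDerivAt_cpow_const_sub (Nat.cast_pos.2 hN) (1 - i) s)).const_mul
      (eulerMaclaurinCoeff i)
  have heq : (fun w => (w - 1)⁻¹ * zetaApprox M N w) =ᶠ[𝓝 s] fun w =>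
      ∑ k ∈ range N, (((k : ℝ) + 1 : ℝ) : ℂ) ^ (0 - w)
        - ∑ i ∈ range (M + 1), eulerMaclaurinCoeff i *
          (cpowCoeff i w * ((N : ℝ) : ℂ) ^ (1 - i - w)) := by
    filter_upwards [isOpen_compl_singleton.mem_nhds hs] with w hw
    rw [zetaApprox, zetaCorrection, mul_sub, inv_mul_cancel_left₀ (sub_ne_zero.2 hw), mul_sum]
    simp only [mul_left_comm (w - 1)⁻¹, inv_mul_cpowDeriv, zero_sub]
    push_cast
    rfl
  refine ((hsum.sub hcorr).congr_of_eventuallyEq heq).congr_deriv ?_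
  rw [sum_neg_distrib]
  push_cast
  simp only [zero_sub]
  congr 1
  refine sum_congr rfl fun i _ => ?_
  ring

lemma cpowCoeff_zero (s : ℂ) : cpowCoeff 0 s = (1 - s)⁻¹ := by
  simp [cpowCoeff]

lemma cpowCoeff_succ (i : ℕ) (s : ℂ) : cpowCoeff (i + 1) s = cpowCoeff i s * (1 - s - i) := by
  rw [cpowCoeff, cpowCoeff, prod_range_succ, mul_div_right_comm]

lemma cpowCoeff_neg_natCast (i j : ℕ) :
    cpowCoeff i (-j) = (j + 1).descFactorial i / (j + 1) := by
  rw [cpowCoeff, ← descPochhammer_eval_eq_descFactorial, descPochhammer_eval_eq_prod_range,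
    sub_neg_eq_add, add_comm (1 : ℂ), Nat.cast_succ]

lemma hasDerivAt_cpowCoeff_neg_natCast {i j : ℕ} (hi : i ≤ j + 1) :
    HasDerivAt (cpowCoeff i) ((j + 1).descFactorial i / (j + 1)
      * (harmonic (j + 1 - i) - harmonic j)) (-j : ℂ) := by
  have hj : (j + 1 : ℂ) ≠ 0 := Nat.cast_add_one_ne_zero j
  induction i with
  | zero =>
    rw [funext cpowCoeff_zero]
    refine (((hasDerivAt_id (-j : ℂ)).const_sub 1).inv
      (by simpa [add_comm] using hj)).congr_deriv ?_
    rw [Nat.sub_zero, harmonic_succ]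
    simp only [Nat.descFactorial_zero, id]
    push_cast
    rw [sub_neg_eq_add, add_comm (1 : ℂ)]
    field_simp
    ring
  | succ i ih =>
    obtain ⟨m, rfl⟩ : ∃ m, j = i + m := ⟨j - i, by omega⟩
    have hm : (m + 1 : ℂ) ≠ 0 := Nat.cast_add_one_ne_zero m
    rw [funext (cpowCoeff_succ i)]
    refine ((ih (by omega)).mul (((hasDerivAt_id _).const_sub 1).sub_const (i : ℂ))).congr_deriv ?_
    rw [cpowCoeff_neg_natCast, Nat.descFactorial_succ, show i + m + 1 - i = m + 1 by omega,
      show i + m + 1 - (i + 1) = m by omega, harmonic_succ]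
    push_cast
    field_simp
    ring

/-- `f N = e N (log N) + o(1)`. Two expansions are compared by comparing the functions `e`, in
which `N` and `log N` are independent variables. -/
def HasLogExpansion (f : ℕ → ℂ) (e : ℂ → ℂ → ℂ) : Prop :=
  Tendsto (fun N : ℕ => f N - e N (Real.log N)) atTop (𝓝 0)

/-- The expansion of `∑ k ≤ N, k ^ j * log k`. -/
noncomputable def powLogExpansion (j : ℕ) (x L : ℂ) : ℂ :=
  ∑ i ∈ range (j + 2), (bernoulli' i * (j + 1).choose i / (j + 1) : ℂ) * x ^ (j + 1 - i)
    * (L + harmonic j - harmonic (j + 1 - i)) - deriv riemannZeta (-j)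

lemma neg_natCast_ne_one (j : ℕ) : (-j : ℂ) ≠ 1 := fun h =>
  Nat.cast_add_one_ne_zero (R := ℂ) j (by linear_combination -h)

lemma eulerMaclaurinCoeff_mul_deriv_cpowCoeff_sub {i j : ℕ} (hi : i ≤ j + 1) (L : ℂ) :
    eulerMaclaurinCoeff i * (deriv (cpowCoeff i) (-j) - cpowCoeff i (-j) * L)
      = -((bernoulli' i * (j + 1).choose i / (j + 1) : ℂ)
        * (L + harmonic j - harmonic (j + 1 - i))) := by
  rw [(hasDerivAt_cpowCoeff_neg_natCast hi).deriv, cpowCoeff_neg_natCast,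
    Nat.descFactorial_eq_factorial_mul_choose, eulerMaclaurinCoeff]
  push_cast
  field_simp [Nat.factorial_ne_zero]
  ring

lemma deriv_inv_mul_zetaApprox_neg_natCast (j : ℕ) {N : ℕ} (hN : 0 < N) :
    deriv (fun w => (w - 1)⁻¹ * zetaApprox (j + 3) N w) (-j : ℂ)
      = -(∑ k ∈ range N, ((k + 1 : ℕ) : ℂ) ^ j * Real.log (k + 1)
          - (powLogExpansion j N (Real.log N) + deriv riemannZeta (-j)))
        - ∑ i ∈ range 2, eulerMaclaurinCoeff (j + 2 + i) * deriv (cpowCoeff (j + 2 + i)) (-j)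
          * ((N : ℂ) ^ (i + 1))⁻¹ := by
  have hlow : ∀ i ∈ range (j + 2), eulerMaclaurinCoeff i *
      (deriv (cpowCoeff i) (-j) - cpowCoeff i (-j) * Real.log N) * (N : ℂ) ^ (1 - i - -j : ℂ)
      = -((bernoulli' i * (j + 1).choose i / (j + 1) : ℂ) * (N : ℂ) ^ (j + 1 - i)
        * (Real.log N + harmonic j - harmonic (j + 1 - i))) := fun i hi => by
    have hi' : i ≤ j + 1 := Nat.lt_succ_iff.1 (mem_range.1 hi)
    rw [eulerMaclaurinCoeff_mul_deriv_cpowCoeff_sub hi', show (1 - i - -j : ℂ) = (j + 1 - i : ℕ) by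
      push_cast [Nat.cast_sub hi']; ring, Complex.cpow_natCast]
    ring
  have hhigh : ∀ i ∈ range 2, eulerMaclaurinCoeff (j + 2 + i) *
      (deriv (cpowCoeff (j + 2 + i)) (-j) - cpowCoeff (j + 2 + i) (-j) * Real.log N)
        * (N : ℂ) ^ (1 - (j + 2 + i : ℕ) - -j : ℂ)
      = eulerMaclaurinCoeff (j + 2 + i) * deriv (cpowCoeff (j + 2 + i)) (-j)
          * ((N : ℂ) ^ (i + 1))⁻¹ := fun i _ => by
    rw [cpowCoeff_neg_natCast, Nat.descFactorial_of_lt (by omega), Nat.cast_zero, zero_div,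
      zero_mul, sub_zero, ← Complex.cpow_natCast, ← Complex.cpow_neg]
    congr 2
    push_cast
    ring
  rw [(hasDerivAt_inv_mul_zetaApprox (neg_natCast_ne_one j) (j + 3) hN).deriv,
    show j + 3 + 1 = j + 2 + 2 by rfl, sum_range_add _ (j + 2) 2, powLogExpansion,
    sum_congr rfl hlow, sum_congr rfl hhigh, sum_neg_distrib]
  simp only [neg_neg, Complex.cpow_natCast, mul_comm (Real.log (_ + 1) : ℂ)]
  ring

lemma hasLogExpansion_sum_pow_mul_log (j : ℕ) :
    HasLogExpansion (fun N => ∑ k ∈ range N, ((k + 1 : ℕ) : ℂ) ^ j * Real.log (k + 1))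
      (powLogExpansion j) := by
  have hzeta := tendsto_deriv_zetaApprox (M := j + 3) (s := -j) (by simp; linarith)
    (neg_natCast_ne_one j)
  have hhigh : Tendsto (fun N : ℕ => ∑ i ∈ range 2, eulerMaclaurinCoeff (j + 2 + i)
      * deriv (cpowCoeff (j + 2 + i)) (-j) * ((N : ℂ) ^ (i + 1))⁻¹) atTop (𝓝 0) := by
    rw [← sum_const_zero (s := range 2)]
    refine tendsto_finsetSum _ fun i _ => ?_
    have hpow := (tendsto_inv_atTop_nhds_zero_nat (𝕜 := ℂ)).pow (i + 1)
    simpa [inv_pow] using hpow.const_mul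
      (eulerMaclaurinCoeff (j + 2 + i) * deriv (cpowCoeff (j + 2 + i)) (-j))
  have hlim := (hzeta.add hhigh).const_sub (deriv riemannZeta (-j))
  rw [add_zero, sub_self] at hlim
  refine hlim.congr' ?_
  filter_upwards [eventually_gt_atTop 0] with N hN
  rw [deriv_inv_mul_zetaApprox_neg_natCast j hN]
  ring

open ComplexConjugate in
lemma ofReal_re_deriv_riemannZeta_ofReal (x : ℝ) :
    ((deriv riemannZeta x).re : ℂ) = deriv riemannZeta x := by
  have hconj : conj ∘ riemannZeta ∘ conj = riemannZeta := funext fun s => by simp [riemannZeta_conj]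
  have := congrFun (deriv_conj_conj (f := riemannZeta)) (x : ℂ)
  rw [hconj, Function.comp_apply, Function.comp_apply, Complex.conj_ofReal] at this
  exact Complex.conj_eq_iff_re.1 this.symm

/-! ### The generalized Bohr-Mollerup theorem -/

lemma sub_eq_sub_of_monotoneOn_of_add_one {p q h : ℝ → ℝ} (hp : MonotoneOn p (Set.Ioi 0))
    (hq : MonotoneOn q (Set.Ioi 0)) (hp_add : ∀ t, 0 < t → p (t + 1) = h t + p t)
    (hq_add : ∀ t, 0 < t → q (t + 1) = h t + q t) (hh : Tendsto h atTop (𝓝 0)) {s t : ℝ}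
    (hs : 0 < s) (hst : s ≤ t) : p t - q t = p s - q s := by
  have hperiodic : ∀ (N : ℕ) (t : ℝ), 0 < t → p (t + N) - q (t + N) = p t - q t := by
    intro N t ht
    induction N with
    | zero => simp
    | succ N ih =>
      rw [Nat.cast_succ, ← add_assoc, hp_add _ (by positivity), hq_add _ (by positivity), ← ih]
      ring
  have hosc : ∀ s t, 0 < s → s ≤ t → t ≤ s + 1 → |(p t - q t) - (p s - q s)| ≤ h s := by
    intro s t hs hst hts
    have ht : 0 < t := hs.trans_le hst
    have hs1 : 0 < s + 1 := by linarith
    rw [abs_le]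
    constructor <;> linarith [hp hs ht hst, hp ht hs1 hts, hq hs ht hst, hq ht hs1 hts,
      hp_add s hs, hq_add s hs]
  set r : ℝ := s + ⌊t - s⌋₊
  have hrs : p r - q r = p s - q s := hperiodic _ s hs
  have hr0 : 0 < r := by positivity
  have hrt : r ≤ t := by linarith [Nat.floor_le (sub_nonneg.2 hst)]
  have htr : t ≤ r + 1 := by linarith [Nat.lt_floor_add_one (t - s)]
  have hlim : Tendsto (fun N : ℕ => h (r + N)) atTop (𝓝 0) :=
    hh.comp (tendsto_atTop_add_const_left _ _ tendsto_natCast_atTop_atTop)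
  have hle : |(p t - q t) - (p r - q r)| ≤ 0 := by
    refine ge_of_tendsto' hlim fun N => ?_
    rw [← hperiodic N t (by linarith), ← hperiodic N r hr0]
    exact hosc _ _ (by positivity) (by linarith) (by linarith)
  rw [← hrs, sub_eq_zero.1 (abs_nonpos_iff.1 hle)]

lemma hasDerivAt_iteratedDeriv {f : ℝ → ℝ} {t : ℝ} (hf : AnalyticAt ℝ f t) (m : ℕ) :
    HasDerivAt (iteratedDeriv m f) (iteratedDeriv (m + 1) f t) t := by
  rw [iteratedDeriv_succ, iteratedDeriv_eq_iterate]
  exact (hf.iterated_deriv m).differentiableAt.hasDerivAt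

lemma iteratedDeriv_add_one {f w : ℝ → ℝ} (hf : AnalyticOnNhd ℝ f (Set.Ioi 0))
    (hadd : ∀ t, 0 < t → f (t + 1) = w t + f t) (m : ℕ) {t : ℝ} (ht : 0 < t) :
    iteratedDeriv m f (t + 1) = iteratedDeriv m w t + iteratedDeriv m f t := by
  have ht1 : t + 1 ∈ Set.Ioi (0 : ℝ) := by
    simp only [Set.mem_Ioi]
    linarith
  have hw : w =ᶠ[𝓝 t] fun t => f (t + 1) - f t := by
    filter_upwards [lt_mem_nhds ht] with s hs using by rw [hadd s hs, add_sub_cancel_right]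
  have hshift : ContDiffAt ℝ m (fun t => f (t + 1)) t :=
    ((hf _ ht1).comp_of_eq (f := fun t : ℝ => t + 1) (by fun_prop) rfl).contDiffAt
  rw [hw.iteratedDeriv_eq, iteratedDeriv_fun_sub hshift (hf t ht).contDiffAt,
    iteratedDeriv_comp_add_const, sub_add_cancel]

lemma eq_of_hasDerivAt_zero {f : ℝ → ℝ} (hf : ∀ t, 0 < t → HasDerivAt f 0 t) {s t : ℝ}
    (hs : 0 < s) (ht : 0 < t) : f s = f t :=
  isOpen_Ioi.is_const_of_deriv_eq_zero isPreconnected_Ioi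
    (fun t ht => (hf t ht).differentiableAt.differentiableWithinAt)
    (fun t ht => (hf t ht).deriv) hs ht

lemma eq_of_periodic_of_iteratedDeriv_eq_zero {d : ℝ → ℝ} (hd : AnalyticOnNhd ℝ d (Set.Ioi 0))
    (hper : ∀ t, 0 < t → d (t + 1) = d t) {m : ℕ}
    (hm : ∀ t, 0 < t → iteratedDeriv (m + 1) d t = 0) {s t : ℝ} (hs : 0 < s) (ht : 0 < t) :
    d s = d t := by
  have hconst : ∀ {m : ℕ}, (∀ t, 0 < t → iteratedDeriv (m + 1) d t = 0) → ∀ {s t : ℝ}, 0 < s →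
      0 < t → iteratedDeriv m d s = iteratedDeriv m d t := fun {m} h =>
    eq_of_hasDerivAt_zero fun t ht => (hasDerivAt_iteratedDeriv (hd t ht) m).congr_deriv (h t ht)
  induction m with
  | zero => simpa using hconst hm hs ht
  | succ m ih =>
    have hper_m : iteratedDeriv m d t = iteratedDeriv m d (t + 1) := by
      rw [iteratedDeriv_add_one hd (w := 0) (fun t ht => by simp [hper t ht]) m ht]
      simp
    obtain ⟨c, hc, hc0⟩ := exists_hasDerivAt_eq_zero (lt_add_one t)
      (fun s hs => (hasDerivAt_iteratedDeriv (hd s (ht.trans_le hs.1)) m).continuousAt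
        |>.continuousWithinAt)
      hper_m (fun s hs => hasDerivAt_iteratedDeriv (hd s (ht.trans hs.1)) m)
    exact ih fun s hs => (hconst hm hs (ht.trans hc.1)).trans hc0

lemma monotoneOn_iteratedDeriv {f : ℝ → ℝ} (hf : AnalyticOnNhd ℝ f (Set.Ioi 0)) {m : ℕ}
    (hnonneg : ∀ t, 0 < t → 0 ≤ iteratedDeriv (m + 1) f t) :
    MonotoneOn (iteratedDeriv m f) (Set.Ioi 0) := by
  have hderiv := fun t (ht : t ∈ Set.Ioi (0 : ℝ)) => hasDerivAt_iteratedDeriv (hf t ht) m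
  refine monotoneOn_of_deriv_nonneg (convex_Ioi 0)
    (fun t ht => (hderiv t ht).continuousAt.continuousWithinAt)
    (fun t ht => (hderiv t (interior_subset ht)).differentiableAt.differentiableWithinAt)
    fun t ht => ?_
  rw [(hderiv t (interior_subset ht)).deriv]
  exact hnonneg t (interior_subset ht)

lemma eq_of_add_one_of_iteratedDeriv_nonneg {m : ℕ} {u v w : ℝ → ℝ}
    (hu : AnalyticOnNhd ℝ u (Set.Ioi 0)) (hv : AnalyticOnNhd ℝ v (Set.Ioi 0))
    (hu_add : ∀ t, 0 < t → u (t + 1) = w t + u t) (hv_add : ∀ t, 0 < t → v (t + 1) = w t + v t)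
    (hu_nonneg : ∀ t, 0 < t → 0 ≤ iteratedDeriv (m + 1) u t)
    (hv_nonneg : ∀ t, 0 < t → 0 ≤ iteratedDeriv (m + 1) v t)
    (hw : Tendsto (iteratedDeriv m w) atTop (𝓝 0)) (hone : u 1 = v 1) {t : ℝ} (ht : 0 < t) :
    u t = v t := by
  set d : ℝ → ℝ := fun t => u t - v t with hd_def
  have hd : AnalyticOnNhd ℝ d (Set.Ioi 0) := hu.sub hv
  have hconst : ∀ s t, 0 < s → s ≤ t → iteratedDeriv m d t = iteratedDeriv m d s := by
    intro s t hs hst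
    have hsub : ∀ t, 0 < t → iteratedDeriv m d t = iteratedDeriv m u t - iteratedDeriv m v t :=
      fun t ht => iteratedDeriv_fun_sub (hu t ht).contDiffAt (hv t ht).contDiffAt
    rw [hsub s hs, hsub t (hs.trans_le hst)]
    exact sub_eq_sub_of_monotoneOn_of_add_one (monotoneOn_iteratedDeriv hu hu_nonneg)
      (monotoneOn_iteratedDeriv hv hv_nonneg) (fun t ht => iteratedDeriv_add_one hu hu_add m ht)
      (fun t ht => iteratedDeriv_add_one hv hv_add m ht) hw hs hst
  have hzero : ∀ t, 0 < t → iteratedDeriv (m + 1) d t = 0 := by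
    intro t ht
    have hloc : iteratedDeriv m d =ᶠ[𝓝 t] fun _ => iteratedDeriv m d (t / 2) := by
      filter_upwards [lt_mem_nhds (half_lt_self ht)] with s hs using hconst _ s (half_pos ht) hs.le
    rw [iteratedDeriv_succ, hloc.deriv_eq, deriv_const]
  have hper : ∀ t, 0 < t → d (t + 1) = d t := fun t ht => by
    simp only [hd_def, hu_add t ht, hv_add t ht, add_sub_add_left_eq_sub]
  have := eq_of_periodic_of_iteratedDeriv_eq_zero hd hper hzero ht one_pos
  simpa [hd_def, hone, sub_eq_zero] using this

lemma eq_of_meromorphicNFOn_univ {f g : ℂ → ℂ} (hf : MeromorphicNFOn f Set.univ)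
    (hg : MeromorphicNFOn g Set.univ) {x : ℂ} (hfg : f =ᶠ[𝓝[≠] x] g) : f = g := by
  have horder : ∀ z, meromorphicOrderAt (f - g) z = ⊤ ↔ f =ᶠ[𝓝[≠] z] g := fun z =>
    meromorphicOrderAt_eq_top_iff.trans (eventually_congr (.of_forall fun w => sub_eq_zero))
  funext z
  have hz : f =ᶠ[𝓝[≠] z] g := by
    rw [← horder]
    by_contra hz
    exact (hf.meromorphicOn.sub hg.meromorphicOn).meromorphicOrderAt_ne_top_of_isPreconnected
      isPreconnected_univ (Set.mem_univ z) (Set.mem_univ x) hz ((horder x).2 hfg)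
  exact ((MeromorphicNFAt.eventuallyEq_nhdsNE_iff_eventuallyEq_nhds
    (hf (Set.mem_univ z)) (hg (Set.mem_univ z))).1 hz).eq_of_nhds

lemma analyticAt_log_re_ofReal {f : ℂ → ℂ} {t : ℝ} (hf : AnalyticAt ℂ f t) (hpos : 0 < (f t).re) :
    AnalyticAt ℝ (fun t : ℝ => Real.log (f t).re) t :=
  (hf.contDiffAt (n := ⊤) |>.real_of_complex.log hpos.ne').analyticAt

/-- The logarithm of a function on the real axis, shifted as in the definition of the multiple
gamma functions. -/
noncomputable def logShift (f : ℂ → ℂ) (t : ℝ) : ℝ :=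
  Real.log (f ((t : ℂ) + 1)).re

namespace IsNextMultipleGamma

variable {n : ℕ} {g f f₁ f₂ : ℂ → ℂ}

lemma analyticAt (h : IsNextMultipleGamma n g f) {t : ℝ} (ht : 0 ≤ t) :
    AnalyticAt ℂ f ((t : ℂ) + 1) := by
  have hne : f ((t : ℂ) + 1) ≠ 0 := fun h0 => by simpa [h0] using (h.pos t ht).2
  have hnf := h.meromorphic (Set.mem_univ ((t : ℂ) + 1))
  exact hnf.meromorphicOrderAt_nonneg_iff_analyticAt.1 (hnf.meromorphicOrderAt_eq_zero_iff.2 hne).ge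

lemma analyticOnNhd_logShift (h : IsNextMultipleGamma n g f) :
    AnalyticOnNhd ℝ (logShift f) (Set.Ioi 0) := fun t ht =>
  analyticAt_log_re_ofReal (f := fun z => f (z + 1))
    ((h.analyticAt (le_of_lt ht)).comp_of_eq (by fun_prop) rfl) (h.pos t (le_of_lt ht)).2

lemma logShift_add_one (h : IsNextMultipleGamma n g f) {t : ℝ} (ht : 0 ≤ t) :
    logShift f (t + 1) = logShift g t + logShift f t := by
  have hmap : f ((t : ℂ) + 1 + 1) = g (t + 1) * f (t + 1) := by
    refine h.map_add_one _ fun m hm => ?_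
    have hre : t + 1 = -(m : ℝ) := by simpa using congrArg Complex.re hm
    linarith [(Nat.cast_nonneg m : (0 : ℝ) ≤ m)]
  have hpos := (h.pos t ht).2
  have hpos_add := (h.pos (t + 1) (by linarith)).2
  simp only [logShift, Complex.ofReal_add, Complex.ofReal_one] at hpos_add ⊢
  rw [hmap, Complex.mul_re, (h.pos t ht).1, mul_zero, sub_zero] at hpos_add ⊢
  exact Real.log_mul (pos_of_mul_pos_left hpos_add hpos.le).ne' hpos.ne'

lemma eq_ofReal_add_one (h₁ : IsNextMultipleGamma n g f₁) (h₂ : IsNextMultipleGamma n g f₂)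
    (hg : Tendsto (iteratedDeriv (n + 1) (logShift g)) atTop (𝓝 0)) {t : ℝ} (ht : 0 < t) :
    f₁ (t + 1) = f₂ (t + 1) := by
  have hlog_zero : logShift f₁ 0 = logShift f₂ 0 := by simp [logShift, h₁.map_one, h₂.map_one]
  have hlog_one : logShift f₁ 1 = logShift f₂ 1 := by
    rw [← zero_add (1 : ℝ), h₁.logShift_add_one le_rfl, h₂.logShift_add_one le_rfl, hlog_zero]
  have hlog : logShift f₁ t = logShift f₂ t :=
    eq_of_add_one_of_iteratedDeriv_nonneg h₁.analyticOnNhd_logShift h₂.analyticOnNhd_logShift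
      (fun t ht => h₁.logShift_add_one ht.le) (fun t ht => h₂.logShift_add_one ht.le)
      (fun t ht => h₁.iteratedDeriv_log_nonneg t ht.le)
      (fun t ht => h₂.iteratedDeriv_log_nonneg t ht.le) hg hlog_one ht
  refine Complex.ext (Real.log_injOn_pos (h₁.pos t ht.le).2 (h₂.pos t ht.le).2 hlog) ?_
  rw [(h₁.pos t ht.le).1, (h₂.pos t ht.le).1]

theorem unique (h₁ : IsNextMultipleGamma n g f₁) (h₂ : IsNextMultipleGamma n g f₂)
    (hg : Tendsto (iteratedDeriv (n + 1) (logShift g)) atTop (𝓝 0)) : f₁ = f₂ := by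
  have htendsto : Tendsto (fun t : ℝ => (t : ℂ) + 1) (𝓝[≠] 1) (𝓝[≠] ((1 : ℝ) + 1)) := by
    have hcont : ContinuousAt (fun t : ℝ => (t : ℂ) + 1) 1 := by fun_prop
    refine hcont.tendsto.inf (tendsto_principal_principal.2 fun t ht => ?_)
    simpa using ht
  have hfreq : ∃ᶠ z in 𝓝[≠] ((1 : ℝ) + 1 : ℂ), f₁ z = f₂ z := by
    refine htendsto.frequently (Eventually.frequently ?_)
    filter_upwards [nhdsWithin_le_nhds (lt_mem_nhds one_pos)] with t ht using
      h₁.eq_ofReal_add_one h₂ hg ht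
  exact eq_of_meromorphicNFOn_univ h₁.meromorphic h₂.meromorphic
    (((h₁.analyticAt zero_le_one).frequently_eq_iff_eventually_eq
      (h₂.analyticAt zero_le_one)).1 hfreq |>.filter_mono nhdsWithin_le_nhds)

end IsNextMultipleGamma

/-! ### Canonical products with polynomial multiplicities -/

lemma differentiableOn_iteratedDeriv {f : ℂ → ℂ} {U : Set ℂ} (hU : IsOpen U)
    (hf : DifferentiableOn ℂ f U) (m : ℕ) : DifferentiableOn ℂ (iteratedDeriv m f) U := by
  induction m with
  | zero => rwa [iteratedDeriv_zero]
  | succ m ih => rw [iteratedDeriv_succ]; exact ih.deriv hU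

lemma hasSumLocallyUniformlyOn_iteratedDeriv {F : ℕ → ℂ → ℂ} {g : ℂ → ℂ} {U : Set ℂ}
    (hU : IsOpen U) (hF : ∀ i, DifferentiableOn ℂ (F i) U) (h : HasSumLocallyUniformlyOn F g U)
    (m : ℕ) : HasSumLocallyUniformlyOn (fun i => iteratedDeriv m (F i)) (iteratedDeriv m g) U := by
  have hFm := fun i => differentiableOn_iteratedDeriv hU (hF i)
  induction m with
  | zero => simpa only [iteratedDeriv_zero] using h
  | succ m ih =>
    rw [hasSumLocallyUniformlyOn_iff_tendstoLocallyUniformlyOn] at ih ⊢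
    simp only [iteratedDeriv_succ]
    refine (ih.deriv (.of_forall fun _ => DifferentiableOn.fun_sum fun i _ => hFm i m) hU).congr
      fun s z hz => ?_
    simp only [Function.comp_apply]
    rw [deriv_fun_sum fun i _ => ((hFm i m).differentiableAt (hU.mem_nhds hz))]

lemma iteratedDeriv_re_ofReal {g : ℂ → ℂ} {U : Set ℂ} (hU : IsOpen U)
    (hg : DifferentiableOn ℂ g U) (m : ℕ) {x : ℝ} (hx : (x : ℂ) ∈ U) :
    iteratedDeriv m (fun t : ℝ => (g t).re) x = (iteratedDeriv m g x).re := by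
  induction m generalizing x with
  | zero => simp only [iteratedDeriv_zero]
  | succ m ih =>
    have hev : iteratedDeriv m (fun t : ℝ => (g t).re) =ᶠ[𝓝 x]
        fun t : ℝ => (iteratedDeriv m g t).re := by
      filter_upwards [Complex.continuous_ofReal.continuousAt.preimage_mem_nhds
        (hU.mem_nhds hx)] with t ht using ih ht
    rw [iteratedDeriv_succ, hev.deriv_eq, iteratedDeriv_succ]
    exact ((differentiableOn_iteratedDeriv hU hg m).differentiableAt
      (hU.mem_nhds hx)).hasDerivAt.real_of_complex.deriv

lemma iteratedDeriv_eval (p : Polynomial ℂ) (m : ℕ) :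
    iteratedDeriv m (fun z => p.eval z) = fun z => (Polynomial.derivative^[m] p).eval z := by
  induction m with
  | zero => rfl
  | succ m ih =>
    rw [iteratedDeriv_succ, ih, Function.iterate_succ_apply']
    exact funext fun z => Polynomial.deriv _

lemma iteratedDeriv_eval_eq_zero {p : Polynomial ℂ} {m : ℕ} (h : p.natDegree < m) (z : ℂ) :
    iteratedDeriv m (fun z => p.eval z) z = 0 := by
  simp only [iteratedDeriv_eval, Polynomial.iterate_derivative_eq_zero h, Polynomial.eval_zero]

lemma aeval_ofReal (P : Polynomial ℝ) (t : ℝ) : Polynomial.aeval (t : ℂ) P = (P.eval t : ℝ) :=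
  Polynomial.aeval_algebraMap_apply ℂ t P

lemma add_natCast_ne_zero {z : ℂ} (hz : -1 < z.re) {k : ℕ} (hk : 1 ≤ k) : z + k ≠ 0 := fun h => by
  have hk' : (1 : ℝ) ≤ k := by exact_mod_cast hk
  have hre := congrArg Complex.re h
  rw [Complex.add_re, Complex.natCast_re, Complex.zero_re] at hre
  linarith

lemma one_add_div_mem_slitPlane {z : ℂ} (hz : -1 < z.re) {k : ℕ} (hk : 1 ≤ k) :
    1 + z / k ∈ Complex.slitPlane := by
  have hk' : (1 : ℝ) ≤ k := by exact_mod_cast hk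
  refine .inl ?_
  rw [Complex.add_re, Complex.one_re, Complex.div_natCast_re,
    ← div_self (by positivity : (k : ℝ) ≠ 0), ← add_div]
  exact div_pos (by linarith) (by linarith)

lemma hasDerivAt_log_one_add_div {z : ℂ} (hz : -1 < z.re) {k : ℕ} (hk : 1 ≤ k) :
    HasDerivAt (fun z : ℂ => Complex.log (1 + z / k)) ((z + k)⁻¹) z := by
  have hk' : (k : ℂ) ≠ 0 := by exact_mod_cast (by omega : k ≠ 0)
  have hsum : (k : ℂ) + z ≠ 0 := by rw [add_comm]; exact add_natCast_ne_zero hz hk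
  refine ((((hasDerivAt_id z).div_const (k : ℂ)).const_add 1).clog
    (one_add_div_mem_slitPlane hz hk)).congr_deriv ?_
  rw [id, add_comm z]
  field_simp

lemma iteratedDeriv_log_one_add_div (m : ℕ) {z : ℂ} (hz : -1 < z.re) {k : ℕ} (hk : 1 ≤ k) :
    iteratedDeriv (m + 1) (fun z : ℂ => Complex.log (1 + z / k)) z
      = (-1) ^ m * m.factorial / (z + k) ^ (m + 1) := by
  induction m generalizing z with
  | zero => simpa using (hasDerivAt_log_one_add_div hz hk).deriv
  | succ m ih =>
    have hev : iteratedDeriv (m + 1) (fun z : ℂ => Complex.log (1 + z / k)) =ᶠ[𝓝 z]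
        fun z => (-1) ^ m * m.factorial / (z + k) ^ (m + 1) := by
      filter_upwards [(isOpen_lt_re (-1)).mem_nhds hz] with w hw using ih hw
    have hne := add_natCast_ne_zero hz hk
    rw [iteratedDeriv_succ, hev.deriv_eq]
    simp only [div_eq_mul_inv]
    refine (((((hasDerivAt_id z).add_const (k : ℂ)).pow (m + 1)).inv
      (pow_ne_zero _ hne)).const_mul ((-1 : ℂ) ^ m * m.factorial)).deriv.trans ?_
    simp only [id, Nat.factorial_succ, Pi.pow_apply, Nat.add_sub_cancel]
    push_cast
    field_simp
    ring

lemma summable_const_mul_one_div_add_one_sq (C : ℝ) :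
    Summable fun i : ℕ => C * (1 / (((i + 1 : ℕ) : ℝ)) ^ 2) :=
  ((summable_nat_add_iff 1).2 (Real.summable_one_div_nat_pow.2 one_lt_two)).mul_left C

lemma one_add_div_ne_zero {z : ℂ} {k : ℕ} (hk : 1 ≤ k) (h : z ≠ -(k : ℂ)) : 1 + z / k ≠ 0 := by
  have hk' : (k : ℂ) ≠ 0 := by exact_mod_cast (by omega : k ≠ 0)
  intro h'
  field_simp at h'
  exact h (by linear_combination h')

lemma ofReal_ne_neg_natCast {t : ℝ} (ht : -1 < t) (k : ℕ) (hk : 1 ≤ k) : (t : ℂ) ≠ -(k : ℂ) :=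
  fun h => add_natCast_ne_zero (z := t) ht hk (by rw [h, neg_add_cancel])

lemma differentiable_logTaylor (n : ℕ) : Differentiable ℂ (Complex.logTaylor n) := by
  unfold Complex.logTaylor
  fun_prop

lemma logTaylor_ofReal (n : ℕ) (t : ℝ) : Complex.logTaylor n t =
    ((∑ j ∈ range n, (-1) ^ (j + 1) * t ^ j / j : ℝ) : ℂ) := by
  rw [Complex.logTaylor]
  push_cast
  rfl

lemma norm_log_one_add_sub_logTaylor_le {w : ℂ} (hw : ‖w‖ ≤ 1 / 2) (i : ℕ) :
    ‖Complex.log (1 + w) - Complex.logTaylor (i + 2) w‖ ≤ ‖w‖ ^ (i + 2) := by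
  have hinv : (1 - ‖w‖)⁻¹ ≤ 2 := by
    rw [inv_le_comm₀ (by linarith) two_pos]
    linarith
  calc ‖Complex.log (1 + w) - Complex.logTaylor (i + 2) w‖
      ≤ ‖w‖ ^ (i + 2) * (1 - ‖w‖)⁻¹ / ((i + 1 : ℕ) + 1) :=
        Complex.norm_log_sub_logTaylor_le (i + 1) (by linarith)
    _ ≤ ‖w‖ ^ (i + 2) * 2 / 2 := by
        gcongr
        push_cast
        linarith [(Nat.cast_nonneg i : (0 : ℝ) ≤ i)]
    _ = ‖w‖ ^ (i + 2) := by ring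

/-- A sequence of multiplicities `mult k = ∑ i < degree, coeff i * k ^ i`, to be the orders of the
zeros of an entire function at the points `-k`. -/
structure ProductWeight where
  degree : ℕ
  coeff : ℕ → ℝ
  mult : ℕ → ℕ
  mult_eq : ∀ k : ℕ, (mult k : ℝ) = ∑ i ∈ range degree, coeff i * (k : ℝ) ^ i

namespace ProductWeight

variable (W : ProductWeight)

/-- The part of `W.mult k * log (1 + z / k)` which has to be subtracted for convergence. -/
noncomputable def taylorPart (z : ℂ) (k : ℕ) : ℂ :=
  ∑ i ∈ range W.degree, W.coeff i * (k : ℂ) ^ i * Complex.logTaylor (i + 2) (z / k)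

/-- The logarithm of a factor of the canonical product. -/
noncomputable def logFactor (z : ℂ) (k : ℕ) : ℂ :=
  W.mult k * Complex.log (1 + z / k) - W.taylorPart z k

/-- A factor of the canonical product. -/
noncomputable def factor (z : ℂ) (k : ℕ) : ℂ :=
  (1 + z / k) ^ W.mult k * Complex.exp (-W.taylorPart z k)

/-- The entire function with zeros of order `W.mult k` at `-k` for `k ≥ 1`, as a canonical
product. -/
noncomputable def canonicalProduct (z : ℂ) : ℂ := ∏' i : ℕ, W.factor z (i + 1)

/-- The logarithm of the canonical product. -/
noncomputable def logSum (z : ℂ) : ℂ := ∑' i : ℕ, W.logFactor z (i + 1)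

lemma cast_mult (k : ℕ) : (W.mult k : ℂ) = ∑ i ∈ range W.degree, W.coeff i * (k : ℂ) ^ i := by
  exact_mod_cast congrArg ((↑) : ℝ → ℂ) (W.mult_eq k)

lemma norm_logFactor_le {R : ℝ} {z : ℂ} (hz : ‖z‖ ≤ R) {k : ℕ} (hk : 1 ≤ k) (hkR : 2 * R ≤ k) :
    ‖W.logFactor z k‖
      ≤ (∑ i ∈ range W.degree, |W.coeff i| * R ^ (i + 2)) * (1 / (k : ℝ) ^ 2) := by
  have hk0 : (0 : ℝ) < k := by exact_mod_cast hk
  have hw : ‖z / k‖ ≤ R / k := by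
    rw [norm_div, Complex.norm_natCast]
    gcongr
  have hw2 : ‖z / k‖ ≤ 1 / 2 := hw.trans (by rw [div_le_iff₀ hk0]; linarith)
  rw [logFactor, taylorPart, W.cast_mult k, sum_mul, ← sum_sub_distrib, sum_mul]
  refine norm_sum_le_of_le _ fun i _ => ?_
  rw [← mul_sub, norm_mul, norm_mul, norm_pow, Complex.norm_natCast, Complex.norm_real,
    Real.norm_eq_abs]
  calc |W.coeff i| * (k : ℝ) ^ i * ‖_‖ ≤ |W.coeff i| * (k : ℝ) ^ i * (R / k) ^ (i + 2) := by
        gcongr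
        exact (norm_log_one_add_sub_logTaylor_le hw2 i).trans (by gcongr)
    _ = |W.coeff i| * R ^ (i + 2) * (1 / (k : ℝ) ^ 2) := by
        rw [div_pow, pow_add (k : ℝ) i 2]
        field_simp

lemma eventually_norm_logFactor_le (R : ℝ) : ∃ C : ℝ, ∀ᶠ i : ℕ in atTop, ∀ z : ℂ, ‖z‖ ≤ R →
    ‖W.logFactor z (i + 1)‖ ≤ C * (1 / (((i + 1 : ℕ) : ℝ)) ^ 2) := by
  refine ⟨∑ i ∈ range W.degree, |W.coeff i| * R ^ (i + 2), ?_⟩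
  filter_upwards [eventually_ge_atTop ⌈2 * R⌉₊] with i hi z hz
  refine W.norm_logFactor_le hz (Nat.le_add_left 1 i) ((Nat.le_ceil _).trans ?_)
  exact_mod_cast hi.trans (Nat.le_succ i)

lemma exp_logFactor {z : ℂ} {k : ℕ} (h : 1 + z / k ≠ 0) :
    Complex.exp (W.logFactor z k) = W.factor z k := by
  rw [logFactor, factor, sub_eq_add_neg, Complex.exp_add, Complex.exp_nat_mul, Complex.exp_log h]

lemma eventually_norm_factor_sub_one_le (R : ℝ) : ∃ C : ℝ, ∀ᶠ i : ℕ in atTop, ∀ z : ℂ, ‖z‖ ≤ R →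
    ‖W.factor z (i + 1) - 1‖ ≤ C * (1 / (((i + 1 : ℕ) : ℝ)) ^ 2) := by
  obtain ⟨C, hC⟩ := W.eventually_norm_logFactor_le R
  refine ⟨2 * C, ?_⟩
  filter_upwards [hC,
    (summable_const_mul_one_div_add_one_sq C).tendsto_atTop_zero.eventually_le_const one_pos,
    eventually_ge_atTop ⌈R⌉₊] with i hi hi_one hiR z hz
  have hne : z ≠ -((i + 1 : ℕ) : ℂ) := by
    rintro rfl
    rw [norm_neg, Complex.norm_natCast] at hz
    exact absurd (Nat.cast_le.1 (hz.trans (Nat.le_ceil R))) (by omega)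
  rw [← W.exp_logFactor (one_add_div_ne_zero (Nat.le_add_left 1 i) hne)]
  refine (Complex.norm_exp_sub_one_le ((hi z hz).trans hi_one)).trans ?_
  linarith [hi z hz]

lemma differentiable_taylorPart (k : ℕ) : Differentiable ℂ fun z => W.taylorPart z k :=
  Differentiable.fun_sum fun i _ =>
    ((differentiable_logTaylor (i + 2)).comp (differentiable_id.div_const _)).const_mul _

lemma differentiable_factor (k : ℕ) : Differentiable ℂ fun z => W.factor z k := by
  have := W.differentiable_taylorPart k
  unfold factor
  fun_prop

lemma hasProdLocallyUniformlyOn_factor (R : ℝ) : HasProdLocallyUniformlyOn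
    (fun (i : ℕ) z => W.factor z (i + 1)) W.canonicalProduct (Metric.ball 0 R) := by
  obtain ⟨C, hC⟩ := W.eventually_norm_factor_sub_one_le R
  have h := Summable.hasProdLocallyUniformlyOn_nat_one_add (K := Metric.ball (0 : ℂ) R)
    (f := fun (i : ℕ) z => W.factor z (i + 1) - 1) Metric.isOpen_ball
    (summable_const_mul_one_div_add_one_sq C)
    (by filter_upwards [hC] with i hi z hz using hi z (mem_ball_zero_iff.1 hz).le)
    fun i => ((W.differentiable_factor (i + 1)).continuous.sub continuous_const).continuousOn
  simp only [add_sub_cancel] at h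
  exact h

lemma hasProd_factor (z : ℂ) :
    HasProd (fun i : ℕ => W.factor z (i + 1)) (W.canonicalProduct z) :=
  (W.hasProdLocallyUniformlyOn_factor (‖z‖ + 1)).hasProd (by simp)

lemma differentiable_canonicalProduct : Differentiable ℂ W.canonicalProduct := by
  intro z
  have h := hasProdLocallyUniformlyOn_iff_tendstoLocallyUniformlyOn.1
    (W.hasProdLocallyUniformlyOn_factor (‖z‖ + 1))
  refine (h.differentiableOn (.of_forall fun _ => ?_) Metric.isOpen_ball).differentiableAt
    (Metric.isOpen_ball.mem_nhds (by simp))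
  exact (Differentiable.fun_finsetProd fun i _ => W.differentiable_factor (i + 1)).differentiableOn

lemma summable_logFactor (z : ℂ) : Summable fun i : ℕ => W.logFactor z (i + 1) := by
  obtain ⟨C, hC⟩ := W.eventually_norm_logFactor_le ‖z‖
  refine (summable_const_mul_one_div_add_one_sq C).of_norm_bounded_eventually_nat ?_
  filter_upwards [hC] with i hi using hi z le_rfl

lemma canonicalProduct_eq_exp {z : ℂ} (hz : ∀ k : ℕ, 1 ≤ k → z ≠ -(k : ℂ)) :
    W.canonicalProduct z = Complex.exp (W.logSum z) :=
  (W.hasProd_factor z).unique <| (W.summable_logFactor z).hasSum.cexp.congr_fun fun _ =>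
    (W.exp_logFactor (one_add_div_ne_zero (by omega) (hz _ (by omega)))).symm

lemma canonicalProduct_ne_zero {z : ℂ} (hz : ∀ k : ℕ, 1 ≤ k → z ≠ -(k : ℂ)) :
    W.canonicalProduct z ≠ 0 := by
  rw [W.canonicalProduct_eq_exp hz]
  exact Complex.exp_ne_zero _

lemma differentiableOn_logFactor {k : ℕ} (hk : 1 ≤ k) :
    DifferentiableOn ℂ (fun z => W.logFactor z k) {z | -1 < z.re} := fun z hz =>
  (((hasDerivAt_log_one_add_div hz hk).differentiableAt.const_mul _).sub
    (W.differentiable_taylorPart k z)).differentiableWithinAt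

lemma hasSumLocallyUniformlyOn_logFactor : HasSumLocallyUniformlyOn
    (fun (i : ℕ) z => W.logFactor z (i + 1)) W.logSum {z | -1 < z.re} := by
  refine SummableLocallyUniformlyOn.hasSumLocallyUniformlyOn
    (SummableLocallyUniformlyOn.of_locally_bounded_eventually (isOpen_lt_re (-1)) ?_)
  intro K _ hK
  obtain ⟨R, hR⟩ := hK.isBounded.exists_norm_le
  obtain ⟨C, hC⟩ := W.eventually_norm_logFactor_le R
  refine ⟨_, summable_const_mul_one_div_add_one_sq C, ?_⟩
  rw [Nat.cofinite_eq_atTop]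
  filter_upwards [hC] with i hi z hz using hi z (hR z hz)

lemma differentiableOn_logSum : DifferentiableOn ℂ W.logSum {z | -1 < z.re} :=
  (hasSumLocallyUniformlyOn_iff_tendstoLocallyUniformlyOn.1
    W.hasSumLocallyUniformlyOn_logFactor).differentiableOn
    (.of_forall fun _ => DifferentiableOn.fun_sum fun i _ =>
      W.differentiableOn_logFactor (Nat.le_add_left 1 i)) (isOpen_lt_re (-1))

/-- `taylorPart` as a polynomial in `z`. -/
noncomputable def taylorPolynomial (k : ℕ) : Polynomial ℂ :=
  ∑ i ∈ range W.degree, ∑ j ∈ range (i + 2),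
    Polynomial.C (W.coeff i * (k : ℂ) ^ i * ((-1) ^ (j + 1) / j / (k : ℂ) ^ j)) * Polynomial.X ^ j

lemma eval_taylorPolynomial (z : ℂ) (k : ℕ) :
    (W.taylorPolynomial k).eval z = W.taylorPart z k := by
  simp only [taylorPolynomial, taylorPart, Complex.logTaylor, Polynomial.eval_finsetSum,
    Polynomial.eval_mul, Polynomial.eval_C, Polynomial.eval_pow, Polynomial.eval_X, mul_sum]
  refine sum_congr rfl fun i _ => sum_congr rfl fun j _ => ?_
  rw [div_pow]
  ring

lemma natDegree_taylorPolynomial_le (k : ℕ) : (W.taylorPolynomial k).natDegree ≤ W.degree := by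
  refine Polynomial.natDegree_sum_le_of_forall_le _ _ fun i hi =>
    Polynomial.natDegree_sum_le_of_forall_le _ _ fun j hj =>
      (Polynomial.natDegree_C_mul_X_pow_le _ _).trans ?_
  rw [mem_range] at hi hj
  omega

lemma iteratedDeriv_logFactor {z : ℂ} (hz : -1 < z.re) {k : ℕ} (hk : 1 ≤ k) :
    iteratedDeriv (W.degree + 1) (fun z => W.logFactor z k) z
      = (-1) ^ W.degree * (W.mult k * W.degree.factorial / (z + k) ^ (W.degree + 1)) := by
  have hlog : ContDiffAt ℂ (W.degree + 1 : ℕ) (fun z : ℂ => Complex.log (1 + z / k)) z :=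
    (Complex.contDiffAt_log (one_add_div_mem_slitPlane hz hk)).comp z
      (f := fun z : ℂ => 1 + z / k) (by fun_prop)
  have htaylor : ContDiffAt ℂ (W.degree + 1 : ℕ) (fun z : ℂ => W.taylorPart z k) z :=
    (W.differentiable_taylorPart k).contDiff.contDiffAt
  simp only [logFactor]
  rw [iteratedDeriv_fun_sub (contDiffAt_const.mul hlog) htaylor, iteratedDeriv_const_mul_field,
    iteratedDeriv_log_one_add_div _ hz hk]
  simp only [← eval_taylorPolynomial]
  rw [iteratedDeriv_eval_eq_zero (Nat.lt_succ_of_le (W.natDegree_taylorPolynomial_le k))]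
  ring

lemma hasSum_iteratedDeriv_logSum {z : ℂ} (hz : -1 < z.re) :
    HasSum (fun i : ℕ => (-1) ^ W.degree * (W.mult (i + 1) * W.degree.factorial
      / (z + (i + 1 : ℕ)) ^ (W.degree + 1))) (iteratedDeriv (W.degree + 1) W.logSum z) :=
  ((hasSumLocallyUniformlyOn_iteratedDeriv (isOpen_lt_re (-1))
    (fun i => W.differentiableOn_logFactor (k := i + 1) (by omega))
    W.hasSumLocallyUniformlyOn_logFactor (W.degree + 1)).hasSum hz).congr_fun fun i =>
      (W.iteratedDeriv_logFactor hz (Nat.le_add_left 1 i)).symm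

lemma im_logFactor_ofReal {t : ℝ} (ht : -1 < t) {k : ℕ} (hk : 1 ≤ k) :
    (W.logFactor t k).im = 0 := by
  have hpos : 0 ≤ 1 + t / k := by
    have := one_add_div_mem_slitPlane (z := t) ht hk
    rw [← Complex.ofReal_natCast, ← Complex.ofReal_div, ← Complex.ofReal_one,
      ← Complex.ofReal_add, Complex.ofReal_mem_slitPlane] at this
    exact this.le
  have hcast : ((t / k : ℝ) : ℂ) = (t : ℂ) / k := by push_cast; rfl
  simp only [logFactor, taylorPart, ← hcast, logTaylor_ofReal]
  norm_cast
  rw [← Complex.ofReal_log hpos]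
  norm_cast

lemma logSum_ofReal {t : ℝ} (ht : -1 < t) : W.logSum t = ((W.logSum t).re : ℂ) := by
  refine Complex.ext rfl ?_
  rw [Complex.ofReal_im, logSum, Complex.im_tsum (W.summable_logFactor t)]
  simp only [W.im_logFactor_ofReal ht (Nat.le_add_left 1 _), tsum_zero]

variable (P : Polynomial ℝ)

/-- The meromorphic function `exp (P z) * (canonical product) ^ (± 1)`, with poles when
`W.degree` is odd. -/
noncomputable def weierstrassGamma (z : ℂ) : ℂ :=
  Complex.exp (Polynomial.aeval z P) * W.canonicalProduct z ^ ((-1 : ℤ) ^ W.degree)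

lemma meromorphicNFOn_weierstrassGamma :
    MeromorphicNFOn (fun z => W.weierstrassGamma P (z - 1)) Set.univ := by
  intro z _
  have hexp : AnalyticAt ℂ (fun z : ℂ => Complex.exp (Polynomial.aeval (z - 1) P)) z :=
    (((Polynomial.differentiable_aeval (R := ℝ) (𝕜 := ℂ) P).comp
      (differentiable_id.sub_const 1)).cexp).analyticAt z
  have hprod : AnalyticAt ℂ (fun z : ℂ => W.canonicalProduct (z - 1)) z :=
    (W.differentiable_canonicalProduct.comp (differentiable_id.sub_const 1)).analyticAt z
  exact (meromorphicNFAt_mul_iff_right hexp (Complex.exp_ne_zero _)).2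
    (hprod.meromorphicNFAt.zpow (n := (-1 : ℤ) ^ W.degree))

/-- The logarithm of `weierstrassGamma` on the half plane `-1 < re z`. -/
noncomputable def logWeierstrassGamma (z : ℂ) : ℂ :=
  Polynomial.aeval z P + (-1) ^ W.degree * W.logSum z

lemma weierstrassGamma_eq_exp {z : ℂ} (hz : ∀ k : ℕ, 1 ≤ k → z ≠ -(k : ℂ)) :
    W.weierstrassGamma P z = Complex.exp (W.logWeierstrassGamma P z) := by
  rw [weierstrassGamma, W.canonicalProduct_eq_exp hz, ← Complex.exp_int_mul, logWeierstrassGamma,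
    Complex.exp_add]
  push_cast
  rfl

lemma weierstrassGamma_ofReal {t : ℝ} (ht : -1 < t) :
    W.weierstrassGamma P t = (Real.exp (W.logWeierstrassGamma P t).re : ℝ) := by
  have hreal : W.logWeierstrassGamma P t = ((W.logWeierstrassGamma P t).re : ℂ) := by
    rw [logWeierstrassGamma, aeval_ofReal, W.logSum_ofReal ht]
    norm_cast
  rw [W.weierstrassGamma_eq_exp P (ofReal_ne_neg_natCast ht), Complex.ofReal_exp, ← hreal]

lemma differentiableOn_logWeierstrassGamma :
    DifferentiableOn ℂ (W.logWeierstrassGamma P) {z | -1 < z.re} :=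
  (Polynomial.differentiable_aeval (R := ℝ) (𝕜 := ℂ) P).differentiableOn.add
    (W.differentiableOn_logSum.const_mul _)

lemma hasSum_iteratedDeriv_logWeierstrassGamma (hP : P.natDegree ≤ W.degree) {z : ℂ}
    (hz : -1 < z.re) :
    HasSum (fun i : ℕ => W.mult (i + 1) * W.degree.factorial
        / (z + (i + 1 : ℕ)) ^ (W.degree + 1))
      (iteratedDeriv (W.degree + 1) (W.logWeierstrassGamma P) z) := by
  have hsum : ContDiffAt ℂ (W.degree + 1 : ℕ) W.logSum z :=
    (W.differentiableOn_logSum.contDiffOn (isOpen_lt_re (-1))).contDiffAt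
      ((isOpen_lt_re (-1)).mem_nhds hz)
  have hpoly : ContDiff ℂ (W.degree + 1 : ℕ) fun z => (P.map (algebraMap ℝ ℂ)).eval z :=
    (Polynomial.differentiable _).contDiff
  have hderiv : iteratedDeriv (W.degree + 1) (W.logWeierstrassGamma P) z
      = (-1) ^ W.degree * iteratedDeriv (W.degree + 1) W.logSum z := by
    unfold logWeierstrassGamma
    simp only [← Polynomial.eval_map_algebraMap]
    rw [iteratedDeriv_fun_add hpoly.contDiffAt (contDiffAt_const.mul hsum),
      iteratedDeriv_eval_eq_zero (Nat.lt_succ_of_le (Polynomial.natDegree_map_le.trans hP)),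
      iteratedDeriv_const_mul_field, zero_add]
  rw [hderiv]
  refine ((W.hasSum_iteratedDeriv_logSum hz).mul_left ((-1 : ℂ) ^ W.degree)).congr_fun fun i => ?_
  rw [← mul_assoc, ← mul_pow, neg_one_mul, neg_neg, one_pow, one_mul]

lemma hasSum_iteratedDeriv_log_weierstrassGamma (hP : P.natDegree ≤ W.degree) {x : ℝ}
    (hx : -1 < x) :
    HasSum (fun i : ℕ => W.mult (i + 1) * W.degree.factorial
        / (x + (i + 1 : ℕ)) ^ (W.degree + 1))
      (iteratedDeriv (W.degree + 1)
        (fun t : ℝ => Real.log (W.weierstrassGamma P t).re) x) := by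
  have hev : (fun t : ℝ => Real.log (W.weierstrassGamma P t).re) =ᶠ[𝓝 x]
      fun t => (W.logWeierstrassGamma P t).re := by
    filter_upwards [lt_mem_nhds hx] with t ht
    rw [W.weierstrassGamma_ofReal P ht, Complex.ofReal_re, Real.log_exp]
  rw [hev.iteratedDeriv_eq, iteratedDeriv_re_ofReal (isOpen_lt_re (-1))
    (W.differentiableOn_logWeierstrassGamma P) _ hx]
  refine (Complex.hasSum_re
    (W.hasSum_iteratedDeriv_logWeierstrassGamma P hP (z := x) hx)).congr_fun fun i => ?_
  norm_cast

lemma exists_mult_le : ∃ C : ℝ, ∀ k : ℕ, 1 ≤ k →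
    (W.mult k : ℝ) * (k : ℝ) ≤ C * (k : ℝ) ^ W.degree := by
  refine ⟨∑ i ∈ range W.degree, |W.coeff i|, fun k hk => ?_⟩
  have hk' : (1 : ℝ) ≤ k := by exact_mod_cast hk
  rw [W.mult_eq k, sum_mul, sum_mul]
  refine sum_le_sum fun i hi => ?_
  rw [mul_assoc, ← pow_succ]
  gcongr
  · exact le_abs_self _
  · exact mem_range.1 hi

lemma tendsto_iteratedDeriv_log_weierstrassGamma (hP : P.natDegree ≤ W.degree) :
    Tendsto (iteratedDeriv (W.degree + 1) fun t : ℝ => Real.log (W.weierstrassGamma P t).re)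
      atTop (𝓝 0) := by
  obtain ⟨C, hC⟩ := W.exists_mult_le
  have hbound : ∀ (x : ℝ) (i : ℕ), 0 ≤ x →
      W.mult (i + 1) * (W.degree.factorial : ℝ) / (x + (i + 1 : ℕ)) ^ (W.degree + 1)
        ≤ C * W.degree.factorial * (1 / ((i + 1 : ℕ) : ℝ) ^ 2) := fun x i hx => by
    calc W.mult (i + 1) * (W.degree.factorial : ℝ) / (x + (i + 1 : ℕ)) ^ (W.degree + 1)
        ≤ W.mult (i + 1) * (W.degree.factorial : ℝ) / ((i + 1 : ℕ) : ℝ) ^ (W.degree + 1) := by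
          gcongr
          linarith
      _ = (W.mult (i + 1) * ((i + 1 : ℕ) : ℝ)) * (W.degree.factorial : ℝ)
          / ((i + 1 : ℕ) : ℝ) ^ (W.degree + 2) := by
          field_simp
          ring
      _ ≤ (C * ((i + 1 : ℕ) : ℝ) ^ W.degree) * (W.degree.factorial : ℝ)
          / ((i + 1 : ℕ) : ℝ) ^ (W.degree + 2) := by
          exact div_le_div_of_nonneg_right (mul_le_mul_of_nonneg_right
            (hC (i + 1) (Nat.le_add_left 1 i)) (by positivity)) (by positivity)
      _ = C * W.degree.factorial * (1 / ((i + 1 : ℕ) : ℝ) ^ 2) := by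
          rw [pow_add]
          field_simp
  have hlim : Tendsto (fun x : ℝ => ∑' i : ℕ, W.mult (i + 1) * (W.degree.factorial : ℝ)
      / (x + (i + 1 : ℕ)) ^ (W.degree + 1)) atTop (𝓝 (∑' _ : ℕ, 0)) := by
    refine tendsto_tsum_of_dominated_convergence
      (summable_const_mul_one_div_add_one_sq (C * W.degree.factorial)) (fun i => ?_) ?_
    · exact tendsto_const_nhds.div_atTop ((tendsto_pow_atTop (Nat.succ_ne_zero _)).comp
        (tendsto_atTop_add_const_right _ _ tendsto_id))
    · filter_upwards [eventually_ge_atTop 0] with x hx i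
      rw [Real.norm_of_nonneg (by positivity)]
      exact hbound x i hx
  rw [tsum_zero] at hlim
  refine hlim.congr' ?_
  filter_upwards [eventually_ge_atTop 0] with x hx
  exact (W.hasSum_iteratedDeriv_log_weierstrassGamma P hP (by linarith)).tsum_eq

lemma weierstrassGamma_zero (hP : P.coeff 0 = 0) : W.weierstrassGamma P 0 = 1 := by
  have hfactor : ∀ k : ℕ, W.factor 0 k = 1 := fun k => by
    simp only [factor, taylorPart, zero_div, Complex.logTaylor_at_zero, mul_zero, sum_const_zero,
      neg_zero, Complex.exp_zero, add_zero, one_pow, mul_one]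
  rw [weierstrassGamma, canonicalProduct, Polynomial.aeval_def, Polynomial.eval₂_at_zero, hP]
  simp only [hfactor, tprod_one, one_zpow, map_zero, Complex.exp_zero, mul_one]

lemma isNextMultipleGamma {n : ℕ} (hn : W.degree = n + 1) (hP : P.natDegree ≤ W.degree)
    (hP0 : P.coeff 0 = 0) {g : ℂ → ℂ}
    (h : ∀ z : ℂ, (∀ k : ℕ, 1 ≤ k → z ≠ -(k : ℂ)) →
      W.weierstrassGamma P (z + 1) = g (z + 1) * W.weierstrassGamma P z) :
    IsNextMultipleGamma n g (fun z => W.weierstrassGamma P (z - 1)) where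
  meromorphic := W.meromorphicNFOn_weierstrassGamma P
  map_add_one z hz := by
    have hpole : ∀ k : ℕ, 1 ≤ k → z - 1 ≠ -(k : ℂ) := fun k hk hzk => by
      refine hz (k - 1) ?_
      push_cast [Nat.cast_sub hk]
      linear_combination hzk
    simpa only [sub_add_cancel, add_sub_cancel_right] using h (z - 1) hpole
  map_one := by rw [sub_self, W.weierstrassGamma_zero P hP0]
  pos x hx := by
    rw [add_sub_cancel_right, W.weierstrassGamma_ofReal P (by linarith), Complex.ofReal_im,
      Complex.ofReal_re]
    exact ⟨rfl, Real.exp_pos _⟩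
  iteratedDeriv_log_nonneg x hx := by
    simp only [add_sub_cancel_right]
    rw [show n + 2 = W.degree + 1 by omega]
    exact (W.hasSum_iteratedDeriv_log_weierstrassGamma P hP (by linarith)).nonneg
      fun i => by positivity

lemma multipleGamma_succ_eq {n : ℕ} (hn : W.degree = n + 1) (hP : P.natDegree ≤ W.degree)
    (hP0 : P.coeff 0 = 0)
    (h : ∀ z : ℂ, (∀ k : ℕ, 1 ≤ k → z ≠ -(k : ℂ)) →
      W.weierstrassGamma P (z + 1) = multipleGamma n (z + 1) * W.weierstrassGamma P z)
    (hlim : Tendsto (iteratedDeriv (n + 1) (logShift (multipleGamma n))) atTop (𝓝 0)) :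
    multipleGamma (n + 1) = fun z => W.weierstrassGamma P (z - 1) := by
  have hgamma := W.isNextMultipleGamma P hn hP hP0 h
  have hnext : IsNextMultipleGamma n (multipleGamma n) (multipleGamma (n + 1)) :=
    Classical.epsilon_spec (p := IsNextMultipleGamma n (multipleGamma n)) ⟨_, hgamma⟩
  exact hnext.unique hgamma hlim

end ProductWeight

/-! ### The functional equation -/

namespace ProductWeight

variable (W V : ProductWeight)

/-- The sum of the differences of the correction terms in the canonical products of `W` at `z + 1`
and at `z` and of `V` at `z`. -/
noncomputable def stepTaylorSum (z : ℂ) (N : ℕ) : ℂ :=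
  ∑ i ∈ range N, (W.taylorPart (z + 1) (i + 1) - W.taylorPart z (i + 1) + V.taylorPart z (i + 1))

/-- If `V.mult` is the difference sequence of `W.mult`, the logarithm of the `N`-th partial product
of `W.canonicalProduct (z + 1) * V.canonicalProduct z / W.canonicalProduct z`, up to `o(1)` and the
contribution of `W.mult 0`. -/
noncomputable def stepLog (z : ℂ) (N : ℕ) : ℂ :=
  W.taylorPart (z + 1) N + W.mult N * Real.log N
    - ∑ i ∈ range N, (V.mult (i + 1) : ℂ) * Real.log (i + 1) - W.stepTaylorSum V z N

variable {W V}

lemma factor_add_one_mul_factor (hb : ∀ k, W.mult (k + 1) = W.mult k + V.mult (k + 1)) (z : ℂ)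
    (N : ℕ) :
    W.factor (z + 1) (N + 1) * V.factor z (N + 1) * ((N + 1 : ℕ) : ℂ) ^ V.mult (N + 1)
        * (N + (z + 1)) ^ W.mult N
      = W.factor z (N + 1) * ((N + 1 : ℕ) + (z + 1)) ^ W.mult (N + 1)
        * Complex.exp (-(W.taylorPart (z + 1) (N + 1) - W.taylorPart z (N + 1)
          + V.taylorPart z (N + 1))) := by
  have hk : ((N + 1 : ℕ) : ℂ) ≠ 0 := by exact_mod_cast Nat.succ_ne_zero N
  have hmul : (1 + z / (N + 1 : ℕ)) * ((N + 1 : ℕ) : ℂ) = N + (z + 1) := by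
    field_simp
    push_cast
    ring
  have hmul_add_one :
      (1 + (z + 1) / (N + 1 : ℕ)) * ((N + 1 : ℕ) : ℂ) = (N + 1 : ℕ) + (z + 1) := by
    field_simp
  have hexp : Complex.exp (-W.taylorPart z (N + 1)) * Complex.exp
        (-(W.taylorPart (z + 1) (N + 1) - W.taylorPart z (N + 1) + V.taylorPart z (N + 1)))
      = Complex.exp (-W.taylorPart (z + 1) (N + 1)) * Complex.exp (-V.taylorPart z (N + 1)) := by
    rw [← Complex.exp_add, ← Complex.exp_add]
    congr 1
    ring
  simp only [factor, ← hmul, ← hmul_add_one, hb, mul_pow, pow_add] at hexp ⊢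
  push_cast at hexp ⊢
  linear_combination -((1 + z / (N + 1)) ^ W.mult N * (1 + z / (N + 1)) ^ V.mult (N + 1)
    * (1 + (z + 1) / (N + 1)) ^ W.mult N * (1 + (z + 1) / (N + 1)) ^ V.mult (N + 1)
    * (N + 1 : ℂ) ^ W.mult N * (N + 1 : ℂ) ^ V.mult (N + 1)) * hexp

lemma prod_factor_add_one (hb : ∀ k, W.mult (k + 1) = W.mult k + V.mult (k + 1)) (z : ℂ) (N : ℕ) :
    (∏ i ∈ range N, W.factor (z + 1) (i + 1)) * (∏ i ∈ range N, V.factor z (i + 1))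
        * (z + 1) ^ W.mult 0 * ∏ i ∈ range N, ((i + 1 : ℕ) : ℂ) ^ V.mult (i + 1)
      = (∏ i ∈ range N, W.factor z (i + 1)) * (N + (z + 1)) ^ W.mult N
        * Complex.exp (-W.stepTaylorSum V z N) := by
  induction N with
  | zero => simp [stepTaylorSum]
  | succ N ih =>
    rw [prod_range_succ, prod_range_succ, prod_range_succ, prod_range_succ]
    rw [stepTaylorSum] at ih ⊢
    rw [sum_range_succ, neg_add, Complex.exp_add]
    linear_combination W.factor (z + 1) (N + 1) * V.factor z (N + 1)
        * ((N + 1 : ℕ) : ℂ) ^ V.mult (N + 1) * ih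
      + (∏ i ∈ range N, W.factor z (i + 1)) * Complex.exp (-∑ i ∈ range N,
        (W.taylorPart (z + 1) (i + 1) - W.taylorPart z (i + 1) + V.taylorPart z (i + 1)))
        * factor_add_one_mul_factor hb z N

lemma prod_pow_mult_eq_exp (V : ProductWeight) (N : ℕ) :
    ∏ i ∈ range N, ((i + 1 : ℕ) : ℂ) ^ V.mult (i + 1)
      = Complex.exp (∑ i ∈ range N, (V.mult (i + 1) : ℂ) * Real.log (i + 1)) := by
  rw [Complex.exp_sum]
  refine prod_congr rfl fun i _ => ?_
  rw [Complex.exp_nat_mul, ← Complex.ofReal_exp, Real.exp_log (by positivity)]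
  push_cast
  rfl

lemma exp_stepLog_add_logFactor {N : ℕ} (hN : 1 ≤ N) {z : ℂ} (hz : 1 + (z + 1) / N ≠ 0) :
    Complex.exp (W.logFactor (z + 1) N + W.stepLog V z N)
        * ∏ i ∈ range N, ((i + 1 : ℕ) : ℂ) ^ V.mult (i + 1)
      = (N + (z + 1)) ^ W.mult N * Complex.exp (-W.stepTaylorSum V z N) := by
  have hN' : (N : ℂ) ≠ 0 := by exact_mod_cast (by omega : N ≠ 0)
  have hpow : (N + (z + 1)) ^ W.mult N
      = Complex.exp (W.mult N * Real.log N) * Complex.exp (W.mult N * Complex.log (1 + (z + 1) / N))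
      := by
    rw [Complex.exp_nat_mul, Complex.exp_nat_mul, Complex.exp_log hz, ← Complex.ofReal_exp,
      Real.exp_log (by positivity), ← mul_pow, Complex.ofReal_natCast, mul_add, mul_one,
      mul_div_cancel₀ _ hN']
  rw [hpow, prod_pow_mult_eq_exp, ← Complex.exp_add, ← Complex.exp_add, ← Complex.exp_add]
  congr 1
  rw [stepLog, logFactor]
  ring

lemma canonicalProduct_add_one_mul (hb : ∀ k, W.mult (k + 1) = W.mult k + V.mult (k + 1)) {z c : ℂ}
    (hz : ∀ k : ℕ, 1 ≤ k → z ≠ -(k : ℂ)) (hc : Tendsto (W.stepLog V z) atTop (𝓝 c)) :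
    W.canonicalProduct (z + 1) * V.canonicalProduct z * (z + 1) ^ W.mult 0
      = W.canonicalProduct z * Complex.exp c := by
  have hlog : Tendsto (W.logFactor (z + 1)) atTop (𝓝 0) :=
    (tendsto_add_atTop_iff_nat 1).1 (W.summable_logFactor (z + 1)).tendsto_atTop_zero
  have hright := (W.hasProd_factor z).tendsto_prod_nat.mul (hlog.add hc).cexp
  rw [zero_add] at hright
  refine tendsto_nhds_unique (((W.hasProd_factor (z + 1)).tendsto_prod_nat.mul
    (V.hasProd_factor z).tendsto_prod_nat).mul_const ((z + 1) ^ W.mult 0)) (hright.congr' ?_)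
  filter_upwards [eventually_ge_atTop 1] with N hN
  have hne : 1 + (z + 1) / N ≠ 0 := one_add_div_ne_zero hN fun h => hz (N + 1) (by omega) <| by
    push_cast
    linear_combination h
  have hprod : ∏ i ∈ range N, ((i + 1 : ℕ) : ℂ) ^ V.mult (i + 1) ≠ 0 := by
    rw [prod_pow_mult_eq_exp]
    exact Complex.exp_ne_zero _
  refine mul_right_cancel₀ hprod ?_
  rw [prod_factor_add_one hb, mul_assoc, mul_assoc, exp_stepLog_add_logFactor hN hne]

lemma weierstrassGamma_add_one (hdeg : W.degree = V.degree + 1)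
    (hb : ∀ k, W.mult (k + 1) = W.mult k + V.mult (k + 1)) (P Q : Polynomial ℝ) {z : ℂ}
    (hz : ∀ k : ℕ, 1 ≤ k → z ≠ -(k : ℂ))
    (hc : Tendsto (W.stepLog V z) atTop (𝓝 ((-1) ^ W.degree *
      (Polynomial.aeval z Q + Polynomial.aeval z P - Polynomial.aeval (z + 1) P)))) :
    W.weierstrassGamma P (z + 1) = ((z + 1) ^ W.mult 0) ^ ((-1 : ℤ) ^ V.degree)
      * V.weierstrassGamma Q z * W.weierstrassGamma P z := by
  have hV := V.canonicalProduct_ne_zero hz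
  have hz' : (z + 1) ^ W.mult 0 ≠ 0 :=
    pow_ne_zero _ fun h => hz 1 le_rfl (by rw [Nat.cast_one]; exact eq_neg_of_add_eq_zero_left h)
  have hprod : W.canonicalProduct (z + 1)
      = W.canonicalProduct z * (V.canonicalProduct z * (z + 1) ^ W.mult 0)⁻¹ *
      Complex.exp ((-1) ^ W.degree *
      (Polynomial.aeval z Q + Polynomial.aeval z P - Polynomial.aeval (z + 1) P)) := by
    rw [mul_right_comm, eq_mul_inv_iff_mul_eq₀ (mul_ne_zero hV hz'), ← mul_assoc,
      canonicalProduct_add_one_mul hb hz hc]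
  have hexp : Complex.exp (Polynomial.aeval (z + 1) P) * Complex.exp ((-1) ^ W.degree *
      (Polynomial.aeval z Q + Polynomial.aeval z P - Polynomial.aeval (z + 1) P))
        ^ ((-1 : ℤ) ^ W.degree)
      = Complex.exp (Polynomial.aeval z Q) * Complex.exp (Polynomial.aeval z P) := by
    rw [← Complex.exp_int_mul, Int.cast_pow, Int.cast_neg, Int.cast_one, ← mul_assoc, ← mul_pow,
      neg_one_mul, neg_neg, one_pow, one_mul, ← Complex.exp_add, ← Complex.exp_add]
    congr 1
    ring
  have hinv : (V.canonicalProduct z * (z + 1) ^ W.mult 0)⁻¹ ^ ((-1 : ℤ) ^ W.degree)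
      = V.canonicalProduct z ^ ((-1 : ℤ) ^ V.degree)
        * ((z + 1) ^ W.mult 0) ^ ((-1 : ℤ) ^ V.degree) := by
    rw [inv_zpow', hdeg, pow_succ, mul_neg_one, neg_neg, mul_zpow]
  rw [weierstrassGamma, weierstrassGamma, weierstrassGamma, hprod, mul_zpow, mul_zpow, hinv]
  linear_combination (W.canonicalProduct z ^ ((-1 : ℤ) ^ W.degree)
    * V.canonicalProduct z ^ ((-1 : ℤ) ^ V.degree)
    * ((z + 1) ^ W.mult 0) ^ ((-1 : ℤ) ^ V.degree)) * hexp

end ProductWeight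

namespace HasLogExpansion

variable {f g : ℕ → ℂ} {d e : ℂ → ℂ → ℂ}

lemma of_eq (h : ∀ N : ℕ, 1 ≤ N → f N = e N (Real.log N)) : HasLogExpansion f e := by
  refine tendsto_const_nhds.congr' ?_
  filter_upwards [eventually_ge_atTop 1] with N hN
  rw [h N hN, sub_self]

lemma congr (hf : HasLogExpansion f e) (h : ∀ N : ℕ, 1 ≤ N → g N = f N) : HasLogExpansion g e := by
  refine Tendsto.congr' ?_ hf
  filter_upwards [eventually_ge_atTop 1] with N hN
  rw [h N hN]

lemma add (hf : HasLogExpansion f d) (hg : HasLogExpansion g e) :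
    HasLogExpansion (fun N => f N + g N) (fun x L => d x L + e x L) := by
  have h := Tendsto.add hf hg
  rw [add_zero] at h
  exact h.congr fun N => by ring

lemma const_mul (c : ℂ) (hf : HasLogExpansion f e) :
    HasLogExpansion (fun N => c * f N) (fun x L => c * e x L) := by
  have h := Tendsto.const_mul c hf
  rw [mul_zero] at h
  exact h.congr fun N => mul_sub c _ _

lemma sub (hf : HasLogExpansion f d) (hg : HasLogExpansion g e) :
    HasLogExpansion (fun N => f N - g N) (fun x L => d x L - e x L) := by
  simpa only [neg_one_mul, ← sub_eq_add_neg] using hf.add (hg.const_mul (-1))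

lemma sum {ι : Type*} {s : Finset ι} {f : ι → ℕ → ℂ} {e : ι → ℂ → ℂ → ℂ}
    (h : ∀ i ∈ s, HasLogExpansion (f i) (e i)) :
    HasLogExpansion (fun N => ∑ i ∈ s, f i N) (fun x L => ∑ i ∈ s, e i x L) := by
  have h := tendsto_finsetSum s h
  rw [sum_const_zero] at h
  exact h.congr fun N => sum_sub_distrib _ _

end HasLogExpansion

lemma hasLogExpansion_harmonic :
    HasLogExpansion (fun N => harmonic N) fun _ L => L + Real.eulerMascheroniConstant := by
  have h := (Complex.continuous_ofReal.tendsto _).comp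
    (Real.tendsto_harmonic_sub_log.sub_const Real.eulerMascheroniConstant)
  rw [sub_self, Complex.ofReal_zero] at h
  refine h.congr fun N => ?_
  simp only [Function.comp_apply]
  push_cast
  ring

lemma pow_mul_logTaylor_div (i : ℕ) (z : ℂ) {x : ℂ} (hx : x ≠ 0) :
    x ^ i * Complex.logTaylor (i + 2) (z / x)
      = ∑ j ∈ range i, (-1) ^ j * z ^ (j + 1) / (j + 1) * x ^ (i - 1 - j)
        + (-1) ^ i * z ^ (i + 1) / (i + 1) * x⁻¹ := by
  rw [Complex.logTaylor, sum_range_succ', sum_range_succ, Nat.cast_zero, div_zero, add_zero,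
    mul_add, mul_sum]
  congr 1
  · refine sum_congr rfl fun j hj => ?_
    obtain ⟨l, rfl⟩ := Nat.exists_eq_add_of_lt (mem_range.1 hj)
    rw [show j + l + 1 - 1 - j = l by omega, div_pow, add_right_comm j l 1, pow_add x (j + 1) l]
    push_cast
    field_simp
    ring
  · push_cast
    rw [div_pow]
    field_simp
    ring

/-- The expansion of `N ^ i * logTaylor (i + 2) (z / N)`. -/
noncomputable def taylorExpansion (i : ℕ) (z x : ℂ) : ℂ :=
  ∑ j ∈ range i, (-1) ^ j * z ^ (j + 1) / (j + 1) * x ^ (i - 1 - j)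

lemma hasLogExpansion_pow_mul_logTaylor (i : ℕ) (z : ℂ) :
    HasLogExpansion (fun N => (N : ℂ) ^ i * Complex.logTaylor (i + 2) (z / N))
      fun x _ => taylorExpansion i z x := by
  have h : Tendsto (fun N : ℕ => (-1) ^ i * z ^ (i + 1) / (i + 1) * (N : ℂ)⁻¹) atTop (𝓝 0) := by
    simpa only [mul_zero] using
      (tendsto_inv_atTop_nhds_zero_nat (𝕜 := ℂ)).const_mul ((-1) ^ i * z ^ (i + 1) / (i + 1))
  refine h.congr' ?_
  filter_upwards [eventually_ge_atTop 1] with N hN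
  rw [pow_mul_logTaylor_div i z (by exact_mod_cast (by omega : N ≠ 0)), taylorExpansion,
    add_sub_cancel_left]

/-- Faulhaber's polynomial, whose value at `N` is `1 ^ m + ⋯ + N ^ m`. -/
noncomputable def faulhaber (m : ℕ) (x : ℂ) : ℂ :=
  ∑ l ∈ range (m + 1), bernoulli' l * (m + 1).choose l * x ^ (m + 1 - l) / (m + 1)

lemma sum_range_add_one_pow (m N : ℕ) :
    ∑ k ∈ range N, ((k + 1 : ℕ) : ℂ) ^ m = faulhaber m N := by
  have h := congrArg (fun q : ℚ => (q : ℂ)) (sum_Ico_pow N m)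
  push_cast [sum_Ico_eq_sum_range, Nat.add_sub_cancel] at h
  rw [faulhaber, ← h]
  refine sum_congr rfl fun k _ => ?_
  push_cast
  rw [add_comm]

/-- The expansion of `∑ k ∈ range N, (k + 1) ^ i * logTaylor (i + 2) (z / (k + 1))`. -/
noncomputable def sumTaylorExpansion (i : ℕ) (z x L : ℂ) : ℂ :=
  ∑ j ∈ range i, (-1) ^ j * z ^ (j + 1) / (j + 1) * faulhaber (i - 1 - j) x
    + (-1) ^ i * z ^ (i + 1) / (i + 1) * (L + Real.eulerMascheroniConstant)

lemma hasLogExpansion_sum_pow_mul_logTaylor (i : ℕ) (z : ℂ) :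
    HasLogExpansion
      (fun N => ∑ k ∈ range N, ((k + 1 : ℕ) : ℂ) ^ i * Complex.logTaylor (i + 2) (z / (k + 1 : ℕ)))
      (sumTaylorExpansion i z) := by
  refine ((HasLogExpansion.sum (s := range i) fun j _ => HasLogExpansion.of_eq
    (e := fun x _ => (-1) ^ j * z ^ (j + 1) / (j + 1) * faulhaber (i - 1 - j) x)
    fun _ _ => rfl).add (hasLogExpansion_harmonic.const_mul _)).congr fun N _ => ?_
  rw [sum_congr rfl fun k _ => pow_mul_logTaylor_div i z (Nat.cast_ne_zero.2 (Nat.succ_ne_zero k)),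
    sum_add_distrib, sum_comm, harmonic]
  simp only [← sum_range_add_one_pow, ← mul_sum]
  push_cast
  simp only [mul_sum]

namespace ProductWeight

variable (W V : ProductWeight)

lemma hasLogExpansion_taylorPart (z : ℂ) : HasLogExpansion (W.taylorPart z)
    fun x _ => ∑ i ∈ range W.degree, W.coeff i * taylorExpansion i z x :=
  (HasLogExpansion.sum fun i _ => (hasLogExpansion_pow_mul_logTaylor i z).const_mul
    (W.coeff i)).congr fun _ _ => sum_congr rfl fun _ _ => mul_assoc _ _ _

lemma hasLogExpansion_sum_taylorPart (z : ℂ) :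
    HasLogExpansion (fun N => ∑ k ∈ range N, W.taylorPart z (k + 1))
      fun x L => ∑ i ∈ range W.degree, W.coeff i * sumTaylorExpansion i z x L := by
  refine (HasLogExpansion.sum fun i _ => (hasLogExpansion_sum_pow_mul_logTaylor i z).const_mul
    (W.coeff i)).congr fun N _ => ?_
  simp only [taylorPart, mul_sum, mul_assoc]
  exact sum_comm

lemma hasLogExpansion_sum_mult_mul_log :
    HasLogExpansion (fun N => ∑ k ∈ range N, (W.mult (k + 1) : ℂ) * Real.log (k + 1))
      fun x L => ∑ i ∈ range W.degree, W.coeff i * powLogExpansion i x L := by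
  refine (HasLogExpansion.sum fun i _ => (hasLogExpansion_sum_pow_mul_log i).const_mul
    (W.coeff i)).congr fun N _ => ?_
  simp only [cast_mult, sum_mul, mul_sum, mul_assoc]
  exact sum_comm

/-- The expansion of `W.stepLog V z`. -/
noncomputable def stepExpansion (z x L : ℂ) : ℂ :=
  ∑ i ∈ range W.degree, W.coeff i * taylorExpansion i (z + 1) x
    + (∑ i ∈ range W.degree, W.coeff i * x ^ i) * L
    - ∑ i ∈ range V.degree, V.coeff i * powLogExpansion i x L
    - (∑ i ∈ range W.degree, W.coeff i * sumTaylorExpansion i (z + 1) x L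
      - ∑ i ∈ range W.degree, W.coeff i * sumTaylorExpansion i z x L
      + ∑ i ∈ range V.degree, V.coeff i * sumTaylorExpansion i z x L)

lemma hasLogExpansion_stepLog (z : ℂ) :
    HasLogExpansion (W.stepLog V z) (W.stepExpansion V z) := by
  have hlog : HasLogExpansion (fun N => W.mult N * Real.log N)
      fun x L => (∑ i ∈ range W.degree, W.coeff i * x ^ i) * L :=
    .of_eq fun N _ => by rw [W.cast_mult]
  refine ((((W.hasLogExpansion_taylorPart (z + 1)).add hlog).sub
    V.hasLogExpansion_sum_mult_mul_log).sub (((W.hasLogExpansion_sum_taylorPart (z + 1)).sub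
      (W.hasLogExpansion_sum_taylorPart z)).add (V.hasLogExpansion_sum_taylorPart z))).congr
    fun N _ => ?_
  rw [stepLog, stepTaylorSum, sum_add_distrib, sum_sub_distrib]

end ProductWeight

/-! ### The Vignéras multiple gamma functions -/

lemma ascFactorial_eq_sum_stirlingFirst (k n : ℕ) :
    k.ascFactorial n = ∑ i ∈ range (n + 1), n.stirlingFirst i * k ^ i := by
  induction n with
  | zero => rfl
  | succ n ih =>
    have hshift : ∑ i ∈ range (n + 1), n.stirlingFirst (i + 1) * k ^ (i + 1) + n.stirlingFirst 0
        = ∑ i ∈ range (n + 1), n.stirlingFirst i * k ^ i := by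
      rw [sum_range_succ, Nat.stirlingFirst_eq_zero_of_lt n.lt_succ_self, zero_mul, add_zero,
        sum_range_succ' _ n, pow_zero, mul_one]
    have hzero : n * n.stirlingFirst 0 = 0 := by cases n <;> simp
    calc k.ascFactorial (n + 1)
        = n * ∑ i ∈ range (n + 1), n.stirlingFirst i * k ^ i
          + k * ∑ i ∈ range (n + 1), n.stirlingFirst i * k ^ i := by
          rw [Nat.ascFactorial_succ, ih, add_mul, add_comm]
      _ = ∑ i ∈ range (n + 1), (n + 1).stirlingFirst (i + 1) * k ^ (i + 1) := by
          nth_rw 1 [← hshift]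
          rw [mul_add, hzero, add_zero, mul_sum, mul_sum, ← sum_add_distrib]
          refine sum_congr rfl fun i _ => ?_
          rw [Nat.stirlingFirst_succ_succ]
          ring
      _ = ∑ i ∈ range (n + 2), (n + 1).stirlingFirst i * k ^ i := by
          rw [sum_range_succ' _ (n + 1), Nat.stirlingFirst_succ_zero, zero_mul, add_zero]

lemma factorial_mul_multichoose (k n : ℕ) : n.factorial * k.multichoose n = k.ascFactorial n := by
  rw [Nat.ascFactorial_eq_factorial_mul_choose', Nat.multichoose_eq]

/-- The orders of the zeros or poles of `G_n (z + 1)` at the points `-k` with `k ≥ 1`: for `n ≥ 1`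
the number of multisets of `n - 1` elements out of `k`. -/
noncomputable def vignerasWeight : ℕ → ProductWeight
  | 0 => ⟨0, 0, 0, fun _ => by simp⟩
  | n + 1 =>
    { degree := n + 1
      coeff := fun i => n.stirlingFirst i / n.factorial
      mult := fun k => k.multichoose n
      mult_eq := fun k => by
        have h := congrArg (fun m : ℕ => (m : ℝ)) ((factorial_mul_multichoose k n).trans
          (ascFactorial_eq_sum_stirlingFirst k n))
        push_cast at h
        simp only [div_mul_eq_mul_div]
        rw [← sum_div, ← h, mul_div_cancel_left₀ _ (by positivity)] }

lemma degree_vignerasWeight : ∀ n : ℕ, (vignerasWeight n).degree = n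
  | 0 => rfl
  | _ + 1 => rfl

lemma mult_vignerasWeight_add_one (n k : ℕ) : (vignerasWeight (n + 1)).mult (k + 1)
    = (vignerasWeight (n + 1)).mult k + (vignerasWeight n).mult (k + 1) := by
  cases n with
  | zero => simp [vignerasWeight]
  | succ n => exact Nat.multichoose_succ_succ k n

section Exponents

open Polynomial

/-- The real number `ζ'(-j)`. -/
noncomputable def zetaDeriv (j : ℕ) : ℝ := (deriv riemannZeta (-j)).re

local notation "γ" => Real.eulerMascheroniConstant

/-- The coefficient of `z ^ (i + 1)` in the exponential factor of `G_n (z + 1)`, for `n ≤ 5`. The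
coefficients for `n + 1` are obtained from those for `n` by solving the triangular linear system
which `stepExpansion_vignerasWeight` amounts to. -/
noncomputable def exponentCoeff : ℕ → ℕ → ℝ
  | 1, 0 => -γ
  | 2, 0 => -zetaDeriv 0 - 1 / 2
  | 2, 1 => -(1 + γ) / 2
  | 3, 0 => 7 / 24 + zetaDeriv 1 + zetaDeriv 0 / 2
  | 3, 1 => 1 / 8 - zetaDeriv 0 / 2 + γ / 4
  | 3, 2 => -1 / 4 - γ / 6
  | 4, 0 => -5 / 24 - zetaDeriv 2 / 2 - zetaDeriv 1 - zetaDeriv 0 / 3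
  | 4, 1 => -5 / 144 + zetaDeriv 1 / 2 + zetaDeriv 0 / 2 - γ / 6
  | 4, 2 => 2 / 9 - zetaDeriv 0 / 6 + γ / 6
  | 4, 3 => -11 / 144 - γ / 24
  | 5, 0 => 469 / 2880 + zetaDeriv 3 / 6 + 3 * zetaDeriv 2 / 4 + 11 * zetaDeriv 1 / 12
      + zetaDeriv 0 / 4
  | 5, 1 => -zetaDeriv 2 / 4 - 3 * zetaDeriv 1 / 4 - 11 * zetaDeriv 0 / 24 + γ / 8
  | 5, 2 => -161 / 864 + zetaDeriv 1 / 6 + zetaDeriv 0 / 4 - 11 * γ / 72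
  | 5, 3 => 7 / 64 - zetaDeriv 0 / 24 + γ / 16
  | 5, 4 => -5 / 288 - γ / 120
  | _, _ => 0

/-- The exponent in the exponential factor of `G_n (z + 1)`, for `n ≤ 5`. -/
noncomputable def exponentPolynomial (n : ℕ) : ℝ[X] :=
  ∑ i ∈ range n, C (exponentCoeff n i) * X ^ (i + 1)

lemma natDegree_exponentPolynomial_le (n : ℕ) : (exponentPolynomial n).natDegree ≤ n :=
  natDegree_sum_le_of_forall_le _ _ fun _ hi =>
    (natDegree_C_mul_X_pow_le _ _).trans (mem_range.1 hi)

lemma coeff_exponentPolynomial_zero (n : ℕ) : (exponentPolynomial n).coeff 0 = 0 := by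
  simp [exponentPolynomial, coeff_X_pow]

lemma aeval_exponentPolynomial (n : ℕ) (z : ℂ) :
    aeval z (exponentPolynomial n) = ∑ i ∈ range n, (exponentCoeff n i : ℂ) * z ^ (i + 1) := by
  simp [exponentPolynomial]

end Exponents

lemma ofReal_zetaDeriv (j : ℕ) : (zetaDeriv j : ℂ) = deriv riemannZeta (-j) := by
  simpa [zetaDeriv] using ofReal_re_deriv_riemannZeta_ofReal (-j)

lemma faulhaber_zero (x : ℂ) : faulhaber 0 x = x := by simp [faulhaber]

lemma faulhaber_one (x : ℂ) : faulhaber 1 x = x ^ 2 / 2 + x / 2 := by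
  norm_num [faulhaber, sum_range_succ]

lemma faulhaber_two (x : ℂ) : faulhaber 2 x = x ^ 3 / 3 + x ^ 2 / 2 + x / 6 := by
  norm_num [faulhaber, sum_range_succ, Nat.choose]
  ring

lemma faulhaber_three (x : ℂ) : faulhaber 3 x = x ^ 4 / 4 + x ^ 3 / 2 + x ^ 2 / 4 := by
  norm_num [faulhaber, sum_range_succ, Nat.choose]
  ring

lemma powLogExpansion_zero (x L : ℂ) :
    powLogExpansion 0 x L = (x + 1 / 2) * L - x - zetaDeriv 0 := by
  norm_num [powLogExpansion, sum_range_succ, ofReal_zetaDeriv]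
  ring

lemma powLogExpansion_one (x L : ℂ) : powLogExpansion 1 x L
    = (x ^ 2 / 2 + x / 2 + 1 / 12) * L - x ^ 2 / 4 + 1 / 12 - zetaDeriv 1 := by
  norm_num [powLogExpansion, sum_range_succ, ofReal_zetaDeriv, harmonic]
  ring

lemma powLogExpansion_two (x L : ℂ) : powLogExpansion 2 x L
    = (x ^ 3 / 3 + x ^ 2 / 2 + x / 6) * L - x ^ 3 / 9 + x / 12 - zetaDeriv 2 := by
  norm_num [powLogExpansion, sum_range_succ, ofReal_zetaDeriv, harmonic, Nat.choose]
  ring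

lemma powLogExpansion_three (x L : ℂ) : powLogExpansion 3 x L
    = (x ^ 4 / 4 + x ^ 3 / 2 + x ^ 2 / 4 - 1 / 120) * L - x ^ 4 / 16 + x ^ 2 / 12 - 11 / 720
      - zetaDeriv 3 := by
  norm_num [powLogExpansion, sum_range_succ, ofReal_zetaDeriv, harmonic, Nat.choose]
  ring

set_option maxHeartbeats 400000 in
-- The five polynomial identities are normalized in a single declaration.
lemma stepExpansion_vignerasWeight {n : ℕ} (hn : n < 5) (z x L : ℂ) :
    (vignerasWeight (n + 1)).stepExpansion (vignerasWeight n) z x L = (-1) ^ (n + 1) *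
      (Polynomial.aeval z (exponentPolynomial n) + Polynomial.aeval z (exponentPolynomial (n + 1))
        - Polynomial.aeval (z + 1) (exponentPolynomial (n + 1))) := by
  simp only [ProductWeight.stepExpansion, degree_vignerasWeight, aeval_exponentPolynomial]
  interval_cases n <;>
    norm_num [sum_range_succ, vignerasWeight, exponentCoeff, taylorExpansion, sumTaylorExpansion,
      Nat.stirlingFirst, Nat.factorial, faulhaber_zero, faulhaber_one, faulhaber_two,
      faulhaber_three, powLogExpansion_zero, powLogExpansion_one, powLogExpansion_two,
      powLogExpansion_three] <;>
    ring

lemma tendsto_stepLog_vignerasWeight {n : ℕ} (hn : n < 5) (z : ℂ) :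
    Tendsto ((vignerasWeight (n + 1)).stepLog (vignerasWeight n) z) atTop (𝓝 ((-1) ^ (n + 1) *
      (Polynomial.aeval z (exponentPolynomial n) + Polynomial.aeval z (exponentPolynomial (n + 1))
        - Polynomial.aeval (z + 1) (exponentPolynomial (n + 1))))) := by
  have h := (vignerasWeight (n + 1)).hasLogExpansion_stepLog (vignerasWeight n) z
  unfold HasLogExpansion at h
  simpa only [stepExpansion_vignerasWeight hn, tendsto_sub_nhds_zero_iff] using h

lemma tendsto_deriv_log_add_one_atTop :
    Tendsto (deriv fun t : ℝ => Real.log (t + 1)) atTop (𝓝 0) := by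
  have hderiv : (deriv fun t : ℝ => Real.log (t + 1)) = fun t => (t + 1)⁻¹ := by
    ext t
    rw [deriv_comp_add_const, Real.deriv_log]
  rw [hderiv]
  exact tendsto_inv_atTop_zero.comp (tendsto_atTop_add_const_right _ _ tendsto_id)

lemma multipleGamma_succ_eq_of_lt {n : ℕ} (hn : n < 5)
    (h : ∀ z, multipleGamma n (z + 1) =
      ((z + 1) ^ (vignerasWeight (n + 1)).mult 0) ^ ((-1 : ℤ) ^ (vignerasWeight n).degree)
        * (vignerasWeight n).weierstrassGamma (exponentPolynomial n) z)
    (hlim : Tendsto (iteratedDeriv (n + 1) (logShift (multipleGamma n))) atTop (𝓝 0)) :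
    multipleGamma (n + 1) =
      fun z => (vignerasWeight (n + 1)).weierstrassGamma (exponentPolynomial (n + 1)) (z - 1) := by
  refine (vignerasWeight (n + 1)).multipleGamma_succ_eq _ (degree_vignerasWeight _)
    ?_ (coeff_exponentPolynomial_zero _) (fun z hz => ?_) hlim
  · simpa only [degree_vignerasWeight] using natDegree_exponentPolynomial_le (n + 1)
  · rw [h]
    refine ProductWeight.weierstrassGamma_add_one (by simp only [degree_vignerasWeight])
      (mult_vignerasWeight_add_one n) _ _ hz ?_
    rw [degree_vignerasWeight]
    exact tendsto_stepLog_vignerasWeight hn z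

theorem multipleGamma_eq {n : ℕ} (h1 : 1 ≤ n) (h5 : n ≤ 5) :
    multipleGamma n =
      fun z => (vignerasWeight n).weierstrassGamma (exponentPolynomial n) (z - 1) := by
  induction n, h1 using Nat.le_induction with
  | base =>
    refine multipleGamma_succ_eq_of_lt (by norm_num) (fun z => ?_) ?_
    · simp [multipleGamma, vignerasWeight, ProductWeight.weierstrassGamma,
        ProductWeight.canonicalProduct, ProductWeight.factor, ProductWeight.taylorPart,
        exponentPolynomial]
    · have hlog : logShift (multipleGamma 0) = fun t => Real.log (t + 1) := by
        ext t
        simp [logShift, multipleGamma]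
      simpa only [zero_add, iteratedDeriv_one, hlog] using tendsto_deriv_log_add_one_atTop
  | succ n h1 ih =>
    obtain ⟨m, rfl⟩ := Nat.exists_eq_add_of_le' h1
    have hn := ih (by omega)
    refine multipleGamma_succ_eq_of_lt (by omega) (fun z => ?_) ?_
    · simp [hn, vignerasWeight]
    · have hlog : logShift (multipleGamma (m + 1)) = fun t : ℝ => Real.log
          ((vignerasWeight (m + 1)).weierstrassGamma (exponentPolynomial (m + 1)) t).re := by
        ext t
        simp only [logShift, hn, add_sub_cancel_right]
      have hdeg := degree_vignerasWeight (m + 1)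
      have hlim := (vignerasWeight (m + 1)).tendsto_iteratedDeriv_log_weierstrassGamma _
        ((natDegree_exponentPolynomial_le (m + 1)).trans hdeg.ge)
      rwa [hlog, ← hdeg]

lemma cast_ascFactorial_ediv_factorial (k n : ℕ) :
    (k.ascFactorial n : ℤ) / n.factorial = (vignerasWeight (n + 1)).mult k := by
  rw [← factorial_mul_multichoose]
  push_cast
  exact Int.mul_ediv_cancel_left _ (by positivity)

lemma weierstrassFactorThree_eq (z : ℂ) (k : ℕ+) :
    weierstrassFactorThree z k = ((vignerasWeight 3).factor z k)⁻¹ := by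
  have hk : ((k : ℕ) : ℂ) ≠ 0 := by simp
  have hmult : (k : ℤ) * ((k : ℤ) + 1) / 2 = (vignerasWeight 3).mult k := by
    rw [← cast_ascFactorial_ediv_factorial]
    norm_num [Nat.ascFactorial, Nat.factorial, mul_comm, mul_assoc, mul_left_comm]
  rw [weierstrassFactorThree, hmult, ProductWeight.factor, mul_inv, zpow_neg, zpow_natCast,
    ← Complex.exp_neg, neg_neg]
  congr 2
  norm_num [ProductWeight.taylorPart, vignerasWeight, Complex.logTaylor, sum_range_succ,
    Nat.stirlingFirst, Nat.factorial]
  field_simp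
  ring

lemma weierstrassFactorFour_eq (z : ℂ) (k : ℕ+) :
    weierstrassFactorFour z k = (vignerasWeight 4).factor z k := by
  have hk : ((k : ℕ) : ℂ) ≠ 0 := by simp
  have hmult : (k : ℤ) * ((k : ℤ) + 1) * ((k : ℤ) + 2) / 6 = (vignerasWeight 4).mult k := by
    rw [← cast_ascFactorial_ediv_factorial]
    norm_num [Nat.ascFactorial, Nat.factorial, mul_comm, mul_assoc, mul_left_comm]
  rw [weierstrassFactorFour, hmult, ProductWeight.factor, zpow_natCast]
  congr 2
  norm_num [ProductWeight.taylorPart, vignerasWeight, Complex.logTaylor, sum_range_succ,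
    Nat.stirlingFirst, Nat.factorial]
  field_simp
  ring

lemma weierstrassFactorFive_eq (z : ℂ) (k : ℕ+) :
    weierstrassFactorFive z k = ((vignerasWeight 5).factor z k)⁻¹ := by
  have hk : ((k : ℕ) : ℂ) ≠ 0 := by simp
  have hmult : (k : ℤ) * ((k : ℤ) + 1) * ((k : ℤ) + 2) * ((k : ℤ) + 3) / 24
      = (vignerasWeight 5).mult k := by
    rw [← cast_ascFactorial_ediv_factorial]
    norm_num [Nat.ascFactorial, Nat.factorial, mul_comm, mul_assoc, mul_left_comm]
  rw [weierstrassFactorFive, hmult, ProductWeight.factor, mul_inv, zpow_neg, zpow_natCast,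
    ← Complex.exp_neg, neg_neg]
  congr 2
  norm_num [ProductWeight.taylorPart, vignerasWeight, Complex.logTaylor, sum_range_succ,
    Nat.stirlingFirst, Nat.factorial]
  field_simp
  ring

lemma hasProd_weierstrassFactorThree {z : ℂ} (hz : ∀ m : ℕ+, z ≠ -(m : ℂ)) :
    HasProd (weierstrassFactorThree z) ((vignerasWeight 3).canonicalProduct z)⁻¹ := by
  have hne := (vignerasWeight 3).canonicalProduct_ne_zero fun k hk => hz ⟨k, hk⟩
  exact ((hasProd_pnat_iff_hasProd_succ.2 ((vignerasWeight 3).hasProd_factor z)).inv₀ hne).congr_fun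
    (weierstrassFactorThree_eq z)

lemma hasProd_weierstrassFactorFour (z : ℂ) :
    HasProd (weierstrassFactorFour z) ((vignerasWeight 4).canonicalProduct z) :=
  (hasProd_pnat_iff_hasProd_succ.2 ((vignerasWeight 4).hasProd_factor z)).congr_fun
    (weierstrassFactorFour_eq z)

lemma hasProd_weierstrassFactorFive {z : ℂ} (hz : ∀ m : ℕ+, z ≠ -(m : ℂ)) :
    HasProd (weierstrassFactorFive z) ((vignerasWeight 5).canonicalProduct z)⁻¹ := by
  have hne := (vignerasWeight 5).canonicalProduct_ne_zero fun k hk => hz ⟨k, hk⟩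
  exact ((hasProd_pnat_iff_hasProd_succ.2 ((vignerasWeight 5).hasProd_factor z)).inv₀ hne).congr_fun
    (weierstrassFactorFive_eq z)

theorem multipleGamma_add_one_eq {n : ℕ} (h1 : 1 ≤ n) (h5 : n ≤ 5) (z : ℂ) :
    multipleGamma n (z + 1) =
      Complex.exp (∑ i ∈ range n, (exponentCoeff n i : ℂ) * z ^ (i + 1)) *
        (vignerasWeight n).canonicalProduct z ^ ((-1 : ℤ) ^ n) := by
  simp only [multipleGamma_eq h1 h5, add_sub_cancel_right, ProductWeight.weierstrassGamma,
    aeval_exponentPolynomial, degree_vignerasWeight]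

end

theorem proposition5p12 :
    (∀ z : ℂ, (∀ m : ℕ+, z ≠ -(m : ℂ)) →
      Multipliable (weierstrassFactorThree z) ∧
      multipleGamma 3 (z + 1) =
        Complex.exp (-(z ^ 3 / 4) + z ^ 2 / 8 + 7 / 24 * z
          + z * deriv riemannZeta (-1)
          - z * (z - 1) / 2 * deriv riemannZeta 0
          - (z ^ 3 / 6 - z ^ 2 / 4) * (Real.eulerMascheroniConstant : ℂ)) *
        ∏' k : ℕ+, weierstrassFactorThree z k) ∧
    (∀ z : ℂ,
      Multipliable (weierstrassFactorFour z) ∧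
      multipleGamma 4 (z + 1) =
        Complex.exp (-(11 / 144 * z ^ 4) + 2 / 9 * z ^ 3 - 5 / 144 * z ^ 2 - 5 / 24 * z
          - z / 2 * deriv riemannZeta (-2)
          + (z ^ 2 - 2 * z) / 2 * deriv riemannZeta (-1)
          - (z ^ 3 - 3 * z ^ 2 + 2 * z) / 6 * deriv riemannZeta 0
          - (z ^ 4 - 4 * z ^ 3 + 4 * z ^ 2) / 24 * (Real.eulerMascheroniConstant : ℂ)) *
        ∏' k : ℕ+, weierstrassFactorFour z k) ∧
    (∀ z : ℂ, (∀ m : ℕ+, z ≠ -(m : ℂ)) →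
      Multipliable (weierstrassFactorFive z) ∧
      multipleGamma 5 (z + 1) =
        Complex.exp (-(5 / 288 * z ^ 5) + 7 / 64 * z ^ 4 - 161 / 864 * z ^ 3 + 469 / 2880 * z
          + z / 6 * deriv riemannZeta (-3)
          - (z ^ 2 - 3 * z) / 4 * deriv riemannZeta (-2)
          + (2 * z ^ 3 - 9 * z ^ 2 + 11 * z) / 12 * deriv riemannZeta (-1)
          - (z ^ 4 - 6 * z ^ 3 + 11 * z ^ 2 - 6 * z) / 24 * deriv riemannZeta 0
          - (6 * z ^ 5 - 45 * z ^ 4 + 110 * z ^ 3 - 90 * z ^ 2) / 720 *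
              (Real.eulerMascheroniConstant : ℂ)) *
        ∏' k : ℕ+, weierstrassFactorFive z k) := by
  refine ⟨fun z hz => ?_, fun z => ?_, fun z hz => ?_⟩
  · have h := hasProd_weierstrassFactorThree hz
    refine ⟨h.multipliable, ?_⟩
    rw [h.tprod_eq, multipleGamma_add_one_eq (by norm_num) (by norm_num),
      Odd.neg_one_pow (by decide), zpow_neg_one]
    congr 2
    norm_num [Finset.sum_range_succ, exponentCoeff, ofReal_zetaDeriv]
    ring
  · have h := hasProd_weierstrassFactorFour z
    refine ⟨h.multipliable, ?_⟩
    rw [h.tprod_eq, multipleGamma_add_one_eq (by norm_num) (by norm_num),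
      Even.neg_one_pow (by decide), zpow_one]
    congr 2
    norm_num [Finset.sum_range_succ, exponentCoeff, ofReal_zetaDeriv]
    ring
  · have h := hasProd_weierstrassFactorFive hz
    refine ⟨h.multipliable, ?_⟩
    rw [h.tprod_eq, multipleGamma_add_one_eq (by norm_num) (by norm_num),
      Odd.neg_one_pow (by decide), zpow_neg_one]
    congr 2
    norm_num [Finset.sum_range_succ, exponentCoeff, ofReal_zetaDeriv]
    ring
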